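/- **Model.** Fix an integer $m\ge 1$ and a real $\delta>-m$. Let $(\mathrm{PA}_t)_{t\ge1}$ be the sequential preferential attachment model: $\mathrm{PA}_1$ is one vertex without edges; $\mathrm{PA}_2$ has two vertices and $m$ edges from vertex $2$ to vertex $1$; for $t\ge 3$, vertex $t$ is added to $\mathrm{PA}_{t-1}$ with $m$ outgoing labelled edges, attached one after the other, where, given all edges attached so far, the $j$-th edge ($1\le j\le m$) goes to $i\in\{1,\dots,t-1\}$ with probability $$\frac{D_i(t-1,j-1)+\delta}{2m(t-2)+(j-1)+(t-1)\delta},$$ $D_i(t-1,j-1)$ being the current degree of $i$ (after the first $j-1$ edges of $t$ have been attached). Put $\tau=3+\delta/m$. **Subgraphs.** Let $H$ be a finite connected directed graph (parallel edges allowed) with vertex set $V_H$, $|V_H|=k$. A copy of $H$ in $\mathrm{PA}_t$ is a subgraph (a set of vertices together with a set of labelled edges) isomorphic to $H$, edges of $\mathrm{PA}_t$ being directed from the younger to the older vertex; $N_t(H)$ is the number of copies. An ordering is a bijection $\pi:V_H\to\{1,\dots,k\}$ ($\pi(u)<\pi(v)$ means that $u$ is older than $v$). It is attainable if every edge of $H$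 from $v$ to $u$ satisfies $\pi(u)<\pi(v)$ and all out-degrees in $H$ are at most $m$. Let $\Pi$ be the set of attainable orderings, and suppose $\Pi\ne\varnothing$. **Exponents.** For $v\in V_H$ let $$\beta(v)=\frac{\tau-2}{\tau-1}\bigl(d^{(\mathrm{in})}_H(v)-d^{(\mathrm{out})}_H(v)\bigr)-d^{(\mathrm{in})}_H(v),$$ where $d^{(\mathrm{in})}_H,d^{(\mathrm{out})}_H$ are the in- and out-degree, and for $\pi\in\Pi$ let $$B(H,\pi)=\max_{s=0,1,\dots,k}\Bigl(-s+\sum_{i=s+1}^k\beta(\pi^{-1}(i))\Bigr).$$ Let $B(H)=\max_{\pi\in\Pi}B(H,\pi)$, and let $r^*$ be the largest number of maximizers $s$ in the definition of $B(H,\pi)$ among all $\pi\in\Pi$ with $B(H,\pi)=B(H)$. **Claim.** $\mathbb{E}[N_t(H)]$ is of order $t^{k+B(H)}\log^{r^*-1}(t)$: there are constants $0<C_1\le C_2<\infty$ (depending on $m,\delta,H$) such that, for all sufficiently large $t$, $$C_1\le\frac{\mathbb{E}[N_t(H)]}{t^{k+B(H)}\log^{r^*-1}(t)}\le C_2 .$$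 -/

import Mathlib

open Filter MeasureTheory

namespace PrefAttach

/-! ### The sequential preferential attachment model

Vertices are numbered `0, 1, 2, …` in order of arrival (vertex `i` here is the `(i+1)`-st vertex).
Every vertex except vertex `0` sends out `m` edges, labelled `0, …, m - 1`, to older vertices.
The labelled edges are numbered in the order in which they are attached: edge number `e` is the
edge with label `e % m` of vertex `e / m + 1`. -/

/-- The vertex from which edge number `e` starts. -/
def source (m e : ℕ) : ℕ := e / m + 1

/-- The graph after the first `N` edges have been attached: it records the end point of each edge,
which is one of the vertices `0, …, source m e - 1`. -/
abbrev Attachments (m N : ℕ) : Type := (e : Fin N) → Fin (source m e)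

/-- The (total) degree of vertex `i` in the graph `G`. -/
def degree {m N : ℕ} (G : Attachments m N) (i : ℕ) : ℕ :=
  (Finset.univ.filter fun e : Fin N => source m e = i).card +
    (Finset.univ.filter fun e : Fin N => (G e : ℕ) = i).card

/-- The conditional probability, given the graph `G` formed by the first `N` edges, that the next
edge is attached to vertex `i`.  The next edge is edge `j = N % m + 1` of the `t`-th vertex, where
`t = N / m + 2`, and the denominator is `2 m (t - 2) + (j - 1) + (t - 1) δ`. -/
noncomputable def attachProb {m N : ℕ} (δ : ℝ) (G : Attachments m N) (i : ℕ) : ℝ :=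
  ((degree G i : ℝ) + δ) /
    (2 * (m : ℝ) * ((N / m : ℕ) : ℝ) + ((N % m : ℕ) : ℝ) + (((N / m : ℕ) : ℝ) + 1) * δ)

theorem sum_degree {m N : ℕ} (hm : 1 ≤ m) (G : Attachments m N) :
    ∑ i : Fin (source m N), degree G i = 2 * m * (N / m) + N % m := by
  have h1 : ∑ i : Fin (source m N),
      (Finset.univ.filter fun e : Fin N => source m e = i).card = m * (N / m) := by
    rw [Fin.sum_univ_eq_sum_range
      (fun i => (Finset.univ.filter fun e : Fin N => source m e = i).card)]
    have hN : m * (N / m) ≤ N := Nat.mul_div_le N m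
    have : (Finset.univ.filter fun e : Fin N => (e : ℕ) < m * (N / m)).card = m * (N / m) := by
      rw [Fin.card_filter_val_lt]; omega
    rw [← this]
    rw [Finset.card_eq_sum_card_fiberwise (f := fun e : Fin N => source m e)
      (t := Finset.range (source m N))]
    · apply Finset.sum_congr rfl
      intro i hi
      apply congrArg Finset.card
      ext e
      simp only [Finset.mem_filter, Finset.mem_univ, true_and, Finset.mem_range] at hi ⊢
      simp only [source] at hi ⊢
      constructor
      · intro h
        refine ⟨?_, h⟩
        rw [mul_comm, ← Nat.div_lt_iff_lt_mul (by omega)]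
        omega
      · exact fun h => h.2
    · intro e he
      simp only [Finset.coe_filter, Finset.mem_univ, true_and, Set.mem_ofPred_eq, source,
        Finset.coe_range, Set.mem_Iio] at he ⊢
      rw [mul_comm, ← Nat.div_lt_iff_lt_mul (by omega)] at he
      omega
  have h2 : ∑ i : Fin (source m N),
      (Finset.univ.filter fun e : Fin N => (G e : ℕ) = i).card = N := by
    rw [Fin.sum_univ_eq_sum_range
      (fun i => (Finset.univ.filter fun e : Fin N => (G e : ℕ) = i).card)]
    have := Finset.card_eq_sum_card_fiberwise (s := (Finset.univ : Finset (Fin N)))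
      (f := fun e : Fin N => (G e : ℕ)) (t := Finset.range (source m N)) (by
        intro e _
        have h := (G e).isLt
        have h' : (e : ℕ) / m ≤ N / m := Nat.div_le_div_right e.isLt.le
        simp only [Finset.coe_range, Set.mem_Iio, source] at h ⊢
        omega)
    rw [← this, Finset.card_univ, Fintype.card_fin]
  simp only [degree, Finset.sum_add_distrib, h1, h2]
  have := Nat.div_add_mod N m
  linarith

theorem le_degree {m N : ℕ} (hm : 1 ≤ m) (hN : m ≤ N) (G : Attachments m N)
    (i : Fin (source m N)) : m ≤ degree G i := by
  have hi : (i : ℕ) ≤ N / m := Nat.lt_succ_iff.mp i.isLt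
  have hle : (i : ℕ) * m ≤ N := (Nat.le_div_iff_mul_le (by omega)).mp hi
  rcases Nat.eq_zero_or_pos (i : ℕ) with h0 | hpos
  · refine le_trans ?_ (Nat.le_add_left _ _)
    have : (Finset.univ.filter fun e : Fin N => (e : ℕ) < m).card = m := by
      rw [Fin.card_filter_val_lt]; omega
    refine this.symm.le.trans (Finset.card_le_card ?_)
    intro e he
    simp only [Finset.mem_filter, Finset.mem_univ, true_and] at he ⊢
    have h := (G e).isLt
    have h' : (e : ℕ) / m = 0 := Nat.div_eq_of_lt he
    simp only [source, h'] at h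
    omega
  · refine le_trans ?_ (Nat.le_add_right _ _)
    have hm1 : (i : ℕ) * m = ((i : ℕ) - 1) * m + m := by
      obtain ⟨k, hk⟩ : ∃ k, (i : ℕ) = k + 1 := ⟨(i : ℕ) - 1, by omega⟩
      rw [hk, Nat.add_sub_cancel]; ring
    let φ : Fin m → Fin N := fun j => ⟨((i : ℕ) - 1) * m + j, by have := j.isLt; omega⟩
    have hφ : Function.Injective φ := by
      intro a b hab
      simp only [φ, Fin.mk.injEq] at hab
      exact Fin.ext (by omega)
    calc m = (Finset.univ.image φ).card := by
          rw [Finset.card_image_of_injective _ hφ, Finset.card_univ, Fintype.card_fin]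
      _ ≤ _ := by
          apply Finset.card_le_card
          intro e he
          simp only [Finset.mem_image, Finset.mem_univ, true_and, Finset.mem_filter] at he ⊢
          obtain ⟨j, rfl⟩ := he
          simp only [φ, source]
          rw [mul_comm, Nat.mul_add_div (by omega), Nat.div_eq_of_lt j.isLt]
          omega

theorem sum_attachProb {m N : ℕ} {δ : ℝ} (hm : 1 ≤ m) (hδ : -(m : ℝ) < δ) (hN : m ≤ N)
    (G : Attachments m N) :
    ∑ i : Fin (source m N), ENNReal.ofReal (attachProb δ G i) = 1 := by
  have hpos : ∀ i : Fin (source m N), 0 < (degree G i : ℝ) + δ := by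
    intro i
    have : (m : ℝ) ≤ degree G i := by exact_mod_cast le_degree hm hN G i
    linarith
  have hsum : ∑ i : Fin (source m N), ((degree G i : ℝ) + δ) =
      2 * (m : ℝ) * ((N / m : ℕ) : ℝ) + ((N % m : ℕ) : ℝ) + (((N / m : ℕ) : ℝ) + 1) * δ := by
    rw [Finset.sum_add_distrib, ← Nat.cast_sum, sum_degree hm G]
    rw [Finset.sum_const, Finset.card_univ, Fintype.card_fin, nsmul_eq_mul]
    simp only [source]
    push_cast
    ring
  have hD : 0 < ∑ i : Fin (source m N), ((degree G i : ℝ) + δ) :=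
    Finset.sum_pos (fun i _ => hpos i) ⟨⟨0, Nat.succ_pos _⟩, Finset.mem_univ _⟩
  rw [← ENNReal.ofReal_sum_of_nonneg]
  · simp only [attachProb, ← hsum]
    rw [← Finset.sum_div, div_self hD.ne', ENNReal.ofReal_one]
  · intro i _
    simp only [attachProb, ← hsum]
    exact (div_pos (hpos i) hD).le

/-- The law of the end point of the next edge, given the graph `G` formed by the first `N` edges.
The `m` edges of the second vertex all go to the first vertex. -/
noncomputable def attachLaw {m : ℕ} {δ : ℝ} (hm : 1 ≤ m) (hδ : -(m : ℝ) < δ) {N : ℕ}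
    (G : Attachments m N) : PMF (Fin (source m N)) :=
  if hN : m ≤ N then
    PMF.ofFintype (fun i => ENNReal.ofReal (attachProb δ G i)) (sum_attachProb hm hδ hN G)
  else
    PMF.pure ⟨0, Nat.succ_pos _⟩

/-- The law of the random graph after `N` edges have been attached one after the other. -/
noncomputable def edgeProcess {m : ℕ} {δ : ℝ} (hm : 1 ≤ m) (hδ : -(m : ℝ) < δ) :
    (N : ℕ) → PMF (Attachments m N)
  | 0 => PMF.pure fun e => e.elim0
  | N + 1 => (edgeProcess hm hδ N).bind fun G => (attachLaw hm hδ G).bind fun i =>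
      PMF.pure (Fin.snoc (α := fun e : Fin (N + 1) => Fin (source m e)) G i)

/-- The law of the preferential attachment graph with `t` vertices, hence `m (t - 1)` edges. -/
noncomputable def PA {m : ℕ} {δ : ℝ} (hm : 1 ≤ m) (hδ : -(m : ℝ) < δ) (t : ℕ) :
    PMF (Attachments m (m * (t - 1))) :=
  edgeProcess hm hδ (m * (t - 1))

/-! ### Directed graphs and their copies -/

/-- A directed graph with vertex set `V` and edge set `E`; parallel edges are allowed
(simple directed graphs are those for which an edge is determined by its two end points). -/
structure DirGraph (V E : Type*) where
  /-- the vertex from which an edge starts -/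
  src : E → V
  /-- the vertex at which an edge ends -/
  tgt : E → V

namespace DirGraph

variable {V E : Type*} [Fintype V] [Fintype E]

/-- Connectedness of the underlying undirected graph. -/
def Connected (H : DirGraph V E) : Prop :=
  (SimpleGraph.fromRel fun u v => ∃ e, H.src e = u ∧ H.tgt e = v).Connected

open Classical in
/-- The in-degree. -/
noncomputable def inDegree (H : DirGraph V E) (v : V) : ℕ :=
  (Finset.univ.filter fun e => H.tgt e = v).card

open Classical in
/-- The out-degree. -/
noncomputable def outDegree (H : DirGraph V E) (v : V) : ℕ :=
  (Finset.univ.filter fun e => H.src e = v).card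

/-- `IsCopy H t G S M`: the set `S` of vertices and the set `M` of labelled edges of the graph `G`
with `t` vertices form a subgraph of `G` that is isomorphic to `H`. -/
def IsCopy (H : DirGraph V E) {m : ℕ} (t : ℕ) (G : Attachments m (m * (t - 1)))
    (S : Finset (Fin t)) (M : Finset (Fin (m * (t - 1)))) : Prop :=
  ∃ (f : V ↪ Fin t) (g : E ↪ Fin (m * (t - 1))),
    (∀ e, source m (g e) = f (H.src e)) ∧ (∀ e, (G (g e) : ℕ) = f (H.tgt e)) ∧
      Finset.univ.map f = S ∧ Finset.univ.map g = M

/-- `N_t(H)`: the number of copies of `H` in the graph `G` with `t` vertices. -/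
noncomputable def numCopies (H : DirGraph V E) {m : ℕ} (t : ℕ)
    (G : Attachments m (m * (t - 1))) : ℕ :=
  {c : Finset (Fin t) × Finset (Fin (m * (t - 1))) | H.IsCopy t G c.1 c.2}.ncard

/-- An ordering of the vertices of `H`; `π u < π v` means that `u` is older than `v`. -/
abbrev Ordering (V : Type*) [Fintype V] : Type _ := V ≃ Fin (Fintype.card V)

/-- `(H, π)` is attainable: the adjacency matrix of `H`, its rows and columns arranged by `π`, is
that of an acyclic graph in which edges go from younger to older vertices, and all out-degrees are
at most `m`. -/
def Attainable (H : DirGraph V E) (m : ℕ) (π : Ordering V) : Prop :=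
  (∀ e, π (H.tgt e) < π (H.src e)) ∧ ∀ v, H.outDegree v ≤ m

/-- The power-law exponent `τ = 3 + δ / m`. -/
noncomputable def tau (m : ℕ) (δ : ℝ) : ℝ := 3 + δ / m

/-- `β(v) = (τ - 2) / (τ - 1) * (d_in(v) - d_out(v)) - d_in(v)`. -/
noncomputable def beta (H : DirGraph V E) (m : ℕ) (δ : ℝ) (v : V) : ℝ :=
  (tau m δ - 2) / (tau m δ - 1) * ((H.inDegree v : ℝ) - H.outDegree v) - H.inDegree v

/-- The objective `-s + ∑_{i = s + 1}^{k} β(π⁻¹(i))` (positions in `Fin k` start at `0`). -/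
noncomputable def objective (H : DirGraph V E) (m : ℕ) (δ : ℝ) (π : Ordering V)
    (s : Fin (Fintype.card V + 1)) : ℝ :=
  -((s : ℕ) : ℝ) +
    ∑ i ∈ Finset.univ.filter (fun i : Fin (Fintype.card V) => (s : ℕ) ≤ i), H.beta m δ (π.symm i)

/-- `B(H, π)`, the maximum of the objective over `s = 0, …, k`. -/
noncomputable def orderedExponent (H : DirGraph V E) (m : ℕ) (δ : ℝ) (π : Ordering V) : ℝ :=
  Finset.univ.sup' Finset.univ_nonempty (H.objective m δ π)

open Classical in
/-- The number of optimizers `s` of the problem that defines `B(H, π)`. -/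
noncomputable def numOptimizers (H : DirGraph V E) (m : ℕ) (δ : ℝ) (π : Ordering V) : ℕ :=
  (Finset.univ.filter fun s => H.objective m δ π s = H.orderedExponent m δ π).card

open Classical in
/-- `Π`, the finite set of orderings `π` such that `(H, π)` is attainable. -/
noncomputable def attainableOrderings (H : DirGraph V E) (m : ℕ) : Finset (Ordering V) :=
  Finset.univ.filter fun π => H.Attainable m π

/-- `B(H)`, the maximum of `B(H, π)` over the attainable orderings. -/
noncomputable def exponent (H : DirGraph V E) (m : ℕ) (δ : ℝ)
    (hA : (H.attainableOrderings m).Nonempty) : ℝ :=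
  (H.attainableOrderings m).sup' hA (H.orderedExponent m δ)

open Classical in
/-- `r*`, the largest number of optimizers among the attainable `π` with `B(H, π) = B(H)`. -/
noncomputable def maxNumOptimizers (H : DirGraph V E) (m : ℕ) (δ : ℝ)
    (hA : (H.attainableOrderings m).Nonempty) : ℕ :=
  ((H.attainableOrderings m).filter fun π =>
    H.orderedExponent m δ π = H.exponent m δ hA).sup (H.numOptimizers m δ)

end DirGraph

/-- `𝔼[N_t(H)]` in the preferential attachment graph with `t` vertices. -/
noncomputable def expectedCopies {V E : Type*} [Fintype V] [Fintype E] {m : ℕ} {δ : ℝ}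
    (hm : 1 ≤ m) (hδ : -(m : ℝ) < δ) (H : DirGraph V E) (t : ℕ) : ℝ :=
  ∫ G, (H.numCopies t G : ℝ) ∂(PA hm hδ t).toMeasure

end PrefAttach

/-!
The expected number of copies is, up to constant factors, a sum over the possible positions of a
copy of the probability that all edges of the copy are attached as prescribed.

This probability is known exactly.  Let the weight of a vertex be its degree plus `δ`.  When a
vertex receives an edge, the rising factorial of its weight with `a` factors is multiplied by
`1 + a / weight`, and the weight cancels against the attachment probability.  Hence the product, over all
vertices, of the rising factorials with as many factors as there are prescribed edges still to
come is a martingale up to deterministic factors (`sum_pending_snoc`): a prescribed edge number `n`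
contributes `1 / denom n`, any other edge contributes `1 + A / denom n`, where `A` counts the
prescribed edges to come whose end point is already there (`expect_agrees`).  Since
`∑ 1 / denom n` grows like `κ log n` with `κ = 1 / (τ - 1)`, an edge from `v` to `u` costs a factor of
order `v ^ (κ - 1) * u ^ (-κ)` (`expect_agrees_bounds`), and collecting these factors at the vertices
gives `∏ v ^ β(v)` (`prod_edgeWeight`).

What is left is, for each attainable ordering, the sum of `∏ q_i ^ b_i` over `q_1 < ⋯ < q_k ≤ t`.
Summing over the largest index, with the other sums known by induction, multiplies the order of
growth by a power of `t` if the exponent is positive, by a logarithm if it is zero, and makes the sum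
bounded if it is negative.  This is the recursion of the maximum of `∑_{i > s} (b_i + 1)` over `s` and
of the number of its maximizers (`orderedSum_bounds`).  The upper bound sums over all embeddings
and all attainable orderings; for the lower bound one optimal ordering with one choice of edge labels
is enough, because an increasing tuple is determined by the set of its entries.
-/

namespace PrefAttach

/-! ### Sums of powers and logarithms -/

/-- The growth scale `n ^ a * log ^ p n`, shifted so that it is positive for every `n`. -/
noncomputable def scale (a : ℝ) (p n : ℕ) : ℝ :=
  ((n : ℝ) + 1) ^ a * (1 + Real.log ((n : ℝ) + 1)) ^ p

theorem one_le_one_add_log (n : ℕ) : 1 ≤ 1 + Real.log ((n : ℝ) + 1) := by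
  have : 0 ≤ Real.log ((n : ℝ) + 1) := Real.log_nonneg (by have := n.cast_nonneg (α := ℝ); linarith)
  linarith

theorem scale_pos (a : ℝ) (p n : ℕ) : 0 < scale a p n := by
  have := one_le_one_add_log n
  unfold scale
  positivity

theorem one_add_log_mono {n t : ℕ} (h : n ≤ t) :
    1 + Real.log ((n : ℝ) + 1) ≤ 1 + Real.log ((t : ℝ) + 1) := by
  have h' : (n : ℝ) ≤ t := by exact_mod_cast h
  have := Real.log_le_log (x := (n : ℝ) + 1) (y := (t : ℝ) + 1) (by positivity) (by linarith)
  linarith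

theorem mul_scale (a b : ℝ) (p n : ℕ) :
    ((n : ℝ) + 1) ^ b * scale a p n = scale (b + a) p n := by
  unfold scale
  rw [Real.rpow_add (by positivity), mul_assoc]

theorem sum_scale_le_of_pos {x : ℝ} (hx : 0 < x) (p : ℕ) :
    ∃ C : ℝ, 0 < C ∧ ∀ t : ℕ, ∑ q ∈ Finset.range t, scale (x - 1) p q ≤ C * scale x p t := by
  have key : ∃ C : ℝ, 0 < C ∧ ∀ t : ℕ,
      ∑ q ∈ Finset.range t, ((q : ℝ) + 1) ^ (x - 1) ≤ C * ((t : ℝ) + 1) ^ x := by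
    rcases le_total 1 x with h1 | h1
    · refine ⟨1, one_pos, fun t => ?_⟩
      calc ∑ q ∈ Finset.range t, ((q : ℝ) + 1) ^ (x - 1)
          ≤ ∑ q ∈ Finset.range t, ((t : ℝ) + 1) ^ (x - 1) := by
            refine Finset.sum_le_sum fun q hq => ?_
            have : (q : ℝ) ≤ t := by exact_mod_cast (Finset.mem_range.mp hq).le
            exact Real.rpow_le_rpow (by positivity) (by linarith) (by linarith)
        _ = t * ((t : ℝ) + 1) ^ (x - 1) := by simp
        _ ≤ ((t : ℝ) + 1) * ((t : ℝ) + 1) ^ (x - 1) := by gcongr; linarith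
        _ = 1 * ((t : ℝ) + 1) ^ x := by
            rw [Real.rpow_sub_one (by positivity)]
            field_simp
    · refine ⟨x⁻¹, inv_pos.mpr hx, fun t => ?_⟩
      -- Bernoulli's inequality makes `q ^ x` grow by at least `x * (q + 1) ^ (x - 1)`.
      have step : ∀ q : ℕ, x * ((q : ℝ) + 1) ^ (x - 1) ≤ ((q + 1 : ℕ) : ℝ) ^ x - (q : ℝ) ^ x := by
        intro q
        have hq : (0 : ℝ) < (q : ℝ) + 1 := by positivity
        have hs : -1 ≤ -(1 / ((q : ℝ) + 1)) := by
          rw [neg_le_neg_iff, div_le_one hq]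
          have := q.cast_nonneg (α := ℝ)
          linarith
        have hB := rpow_one_add_le_one_add_mul_self hs hx.le h1
        have hrew : 1 + -(1 / ((q : ℝ) + 1)) = q / (q + 1) := by field_simp; ring
        rw [hrew, Real.div_rpow (by positivity) hq.le, div_le_iff₀ (by positivity)] at hB
        rw [Real.rpow_sub_one hq.ne']
        push_cast
        have : (1 + x * -(1 / ((q : ℝ) + 1))) * ((q : ℝ) + 1) ^ x =
            ((q : ℝ) + 1) ^ x - x * (((q : ℝ) + 1) ^ x / (q + 1)) := by ring
        linarith
      have hsum := Finset.sum_le_sum (s := Finset.range t) fun q _ => step q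
      rw [Finset.sum_range_sub (fun q : ℕ => (q : ℝ) ^ x), ← Finset.mul_sum] at hsum
      have h0 : ((0 : ℕ) : ℝ) ^ x = 0 := by rw [Nat.cast_zero, Real.zero_rpow hx.ne']
      have h2 : (t : ℝ) ^ x ≤ ((t : ℝ) + 1) ^ x :=
        Real.rpow_le_rpow (by positivity) (by linarith) hx.le
      rw [h0, sub_zero] at hsum
      rw [inv_mul_eq_div, le_div_iff₀ hx]
      linarith
  obtain ⟨C, hC, h⟩ := key
  refine ⟨C, hC, fun t => ?_⟩
  calc ∑ q ∈ Finset.range t, scale (x - 1) p q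
      ≤ ∑ q ∈ Finset.range t, ((q : ℝ) + 1) ^ (x - 1) * (1 + Real.log ((t : ℝ) + 1)) ^ p := by
        refine Finset.sum_le_sum fun q hq => ?_
        have h1 := one_le_one_add_log q
        have h2 := one_add_log_mono (Finset.mem_range.mp hq).le
        unfold scale
        gcongr
    _ ≤ C * ((t : ℝ) + 1) ^ x * (1 + Real.log ((t : ℝ) + 1)) ^ p := by
        rw [← Finset.sum_mul]
        have h1 := one_le_one_add_log t
        have := h t
        gcongr
    _ = C * scale x p t := by unfold scale; ring

theorem sum_scale_le_of_zero (p : ℕ) :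
    ∀ t : ℕ, ∑ q ∈ Finset.range t, scale (-1) p q ≤ scale 0 (p + 1) t := by
  intro t
  calc ∑ q ∈ Finset.range t, scale (-1) p q
      ≤ ∑ q ∈ Finset.range t, ((q : ℝ) + 1)⁻¹ * (1 + Real.log ((t : ℝ) + 1)) ^ p := by
        refine Finset.sum_le_sum fun q hq => ?_
        have h1 := one_le_one_add_log q
        have h2 := one_add_log_mono (Finset.mem_range.mp hq).le
        unfold scale
        rw [Real.rpow_neg_one]
        gcongr
    _ = (harmonic t : ℝ) * (1 + Real.log ((t : ℝ) + 1)) ^ p := by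
        rw [← Finset.sum_mul]
        simp [harmonic]
    _ ≤ (1 + Real.log ((t : ℝ) + 1)) * (1 + Real.log ((t : ℝ) + 1)) ^ p := by
        have h1 := one_le_one_add_log t
        have h2 := harmonic_le_one_add_log t
        have h3 : Real.log t ≤ Real.log ((t : ℝ) + 1) := by
          rcases Nat.eq_zero_or_pos t with rfl | ht
          · simp
          · have : (0 : ℝ) < t := by exact_mod_cast ht
            exact Real.log_le_log this (by linarith)
        gcongr
        linarith
    _ = scale 0 (p + 1) t := by unfold scale; rw [Real.rpow_zero]; ring

theorem exists_one_add_log_pow_le {ε : ℝ} (hε : 0 < ε) (p : ℕ) :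
    ∃ C : ℝ, 0 < C ∧ ∀ n : ℕ, (1 + Real.log ((n : ℝ) + 1)) ^ p ≤ C * ((n : ℝ) + 1) ^ ε := by
  -- The exponent `η` is so small that `p` logarithms cost at most `ε`.
  set η : ℝ := ε / (p + 1) with hη
  have hη0 : 0 < η := by positivity
  have hηp : η * p ≤ ε := by
    rw [hη, div_mul_eq_mul_div, div_le_iff₀ (by positivity)]
    nlinarith
  refine ⟨(1 + η⁻¹) ^ p, by positivity, fun n => ?_⟩
  have hn0 := n.cast_nonneg (α := ℝ)
  have hn : (0 : ℝ) < (n : ℝ) + 1 := by positivity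
  have h1 := one_le_one_add_log n
  have hl : 1 + Real.log ((n : ℝ) + 1) ≤ (1 + η⁻¹) * ((n : ℝ) + 1) ^ η := by
    have ha := Real.log_le_rpow_div hn.le hη0
    have hb : 1 ≤ ((n : ℝ) + 1) ^ η := Real.one_le_rpow (by linarith) hη0.le
    rw [div_eq_inv_mul] at ha
    linarith [add_mul 1 η⁻¹ (((n : ℝ) + 1) ^ η)]
  calc (1 + Real.log ((n : ℝ) + 1)) ^ p ≤ ((1 + η⁻¹) * ((n : ℝ) + 1) ^ η) ^ p := by gcongr
    _ = (1 + η⁻¹) ^ p * ((n : ℝ) + 1) ^ (η * p) := by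
        rw [mul_pow, Real.rpow_mul hn.le, Real.rpow_natCast]
    _ ≤ (1 + η⁻¹) ^ p * ((n : ℝ) + 1) ^ ε := by
        have : ((n : ℝ) + 1) ^ (η * p) ≤ ((n : ℝ) + 1) ^ ε :=
          Real.rpow_le_rpow_of_exponent_le (by linarith) hηp
        gcongr

theorem scale_le_scale {a a' : ℝ} {p p' : ℕ} (h : a < a' ∨ a = a' ∧ p ≤ p') :
    ∃ C : ℝ, 0 < C ∧ ∀ n : ℕ, scale a p n ≤ C * scale a' p' n := by
  rcases h with h | ⟨rfl, h⟩
  · obtain ⟨C, hC, hC'⟩ := exists_one_add_log_pow_le (sub_pos.mpr h) p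
    refine ⟨C, hC, fun n => ?_⟩
    have h1 := one_le_one_add_log n
    calc scale a p n ≤ ((n : ℝ) + 1) ^ a * (C * ((n : ℝ) + 1) ^ (a' - a)) := by
          unfold scale
          have := hC' n
          gcongr
      _ = C * ((n : ℝ) + 1) ^ a' * 1 := by
          rw [Real.rpow_sub (by positivity)]
          field_simp
      _ ≤ C * ((n : ℝ) + 1) ^ a' * (1 + Real.log ((n : ℝ) + 1)) ^ p' := by
          have := one_le_pow₀ h1 (n := p')
          gcongr
      _ = C * scale a' p' n := by
          unfold scale
          ring
  · refine ⟨1, one_pos, fun n => ?_⟩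
    have h1 := one_le_one_add_log n
    unfold scale
    rw [one_mul]
    gcongr

theorem sum_scale_le_of_neg {x : ℝ} (hx : x < 0) (p : ℕ) :
    ∃ C : ℝ, 0 < C ∧ ∀ t : ℕ, ∑ q ∈ Finset.range t, scale (x - 1) p q ≤ C := by
  obtain ⟨A, hA, hA'⟩ := scale_le_scale (p := p) (p' := 0)
    (Or.inl (by linarith : x - 1 < x / 2 - 1))
  have hterm : ∀ q : ℕ, scale (x - 1) p q ≤ A * ((q + 1 : ℕ) : ℝ) ^ (x / 2 - 1) := by
    intro q
    simpa [scale] using hA' q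
  have hsum : Summable fun q : ℕ => A * ((q + 1 : ℕ) : ℝ) ^ (x / 2 - 1) :=
    ((summable_nat_add_iff 1).mpr
      (Real.summable_nat_rpow.mpr (by linarith : x / 2 - 1 < -1))).mul_left _
  have hnn : ∀ q : ℕ, 0 ≤ A * ((q + 1 : ℕ) : ℝ) ^ (x / 2 - 1) := fun q => by positivity
  refine ⟨∑' q : ℕ, A * ((q + 1 : ℕ) : ℝ) ^ (x / 2 - 1) + 1, by positivity, fun t => ?_⟩
  have h1 := Finset.sum_le_sum (s := Finset.range t) fun q _ => hterm q
  have h2 := hsum.sum_le_tsum (Finset.range t) fun q _ => hnn q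
  linarith

theorem le_sum_scale_of_pos {x : ℝ} (hx : 0 < x) (p q₀ : ℕ) :
    ∃ c : ℝ, 0 < c ∧ ∀ᶠ t : ℕ in atTop,
      c * scale x p t ≤ ∑ q ∈ Finset.Ico q₀ t, scale (x - 1) p q := by
  refine ⟨(1 / 4) * (1 / 2) ^ x * (1 / 2) ^ p, by positivity, ?_⟩
  filter_upwards [eventually_ge_atTop (2 * q₀ + 1)] with t ht
  have ht1 : (1 : ℝ) ≤ t := by exact_mod_cast (by omega : 1 ≤ t)
  have hterm : ∀ q ∈ Finset.Ico (t / 2) t,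
      (1 / 2) ^ x * (1 / 2) ^ p * scale x p t / ((t : ℝ) + 1) ≤ scale (x - 1) p q := by
    intro q hq
    rw [Finset.mem_Ico] at hq
    have h1 : (t : ℝ) + 1 ≤ 2 * ((q : ℝ) + 1) := by exact_mod_cast (by omega : t + 1 ≤ 2 * (q + 1))
    have h2 : (q : ℝ) + 1 ≤ (t : ℝ) + 1 := by exact_mod_cast (by omega : q + 1 ≤ t + 1)
    have hlog : (1 / 2) * (1 + Real.log ((t : ℝ) + 1)) ≤ 1 + Real.log ((q : ℝ) + 1) := by
      have ha : Real.log ((t : ℝ) + 1) ≤ Real.log 2 + Real.log ((q : ℝ) + 1) := by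
        rw [← Real.log_mul (by norm_num) (by positivity)]
        exact Real.log_le_log (by positivity) h1
      have hb : Real.log 2 ≤ 1 := by
        have := Real.log_two_lt_d9
        linarith
      have hc := one_le_one_add_log q
      linarith
    have hpow : (1 / 2) ^ x * ((t : ℝ) + 1) ^ x ≤ ((q : ℝ) + 1) ^ x := by
      rw [← Real.mul_rpow (by norm_num) (by positivity)]
      exact Real.rpow_le_rpow (by positivity) (by linarith) hx.le
    have hl := one_le_one_add_log t
    calc (1 / 2) ^ x * (1 / 2) ^ p * scale x p t / ((t : ℝ) + 1)
        = ((1 / 2) ^ x * ((t : ℝ) + 1) ^ x) * ((1 / 2) * (1 + Real.log ((t : ℝ) + 1))) ^ p /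
            ((t : ℝ) + 1) := by
          unfold scale
          rw [mul_pow]
          ring
      _ ≤ ((q : ℝ) + 1) ^ x * (1 + Real.log ((q : ℝ) + 1)) ^ p / ((q : ℝ) + 1) := by
          have h3 := one_le_one_add_log q
          gcongr
      _ = scale (x - 1) p q := by
          unfold scale
          rw [Real.rpow_sub_one (by positivity)]
          ring
  have hcard : ((t : ℝ) + 1) * (1 / 4) ≤ ((t - t / 2 : ℕ) : ℝ) := by
    have : ((t + 1 : ℕ) : ℝ) ≤ ((4 * (t - t / 2) : ℕ) : ℝ) := by exact_mod_cast (by omega)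
    push_cast at this ⊢
    linarith
  calc (1 / 4) * (1 / 2) ^ x * (1 / 2) ^ p * scale x p t
      = (((t : ℝ) + 1) * (1 / 4)) *
          ((1 / 2) ^ x * (1 / 2) ^ p * scale x p t / ((t : ℝ) + 1)) := by
        field_simp
    _ ≤ ((t - t / 2 : ℕ) : ℝ) *
          ((1 / 2) ^ x * (1 / 2) ^ p * scale x p t / ((t : ℝ) + 1)) := by
        have := scale_pos x p t
        gcongr
    _ = ∑ q ∈ Finset.Ico (t / 2) t,
          ((1 / 2) ^ x * (1 / 2) ^ p * scale x p t / ((t : ℝ) + 1)) := by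
        rw [Finset.sum_const, Nat.card_Ico, nsmul_eq_mul]
    _ ≤ ∑ q ∈ Finset.Ico (t / 2) t, scale (x - 1) p q := Finset.sum_le_sum hterm
    _ ≤ ∑ q ∈ Finset.Ico q₀ t, scale (x - 1) p q := by
        refine Finset.sum_le_sum_of_subset_of_nonneg ?_ fun q _ _ => (scale_pos _ _ _).le
        exact Finset.Ico_subset_Ico (by omega) le_rfl

theorem pow_succ_sub_pow_succ_le {a b : ℝ} (hb : 0 ≤ b) (hab : b ≤ a) (p : ℕ) :
    a ^ (p + 1) - b ^ (p + 1) ≤ (p + 1) * a ^ p * (a - b) := by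
  induction p with
  | zero => simp
  | succ p ih =>
    have h1 : b ^ (p + 1) ≤ a ^ (p + 1) := pow_le_pow_left₀ hb hab _
    have h2 : a * (a ^ (p + 1) - b ^ (p + 1)) ≤ a * ((p + 1) * a ^ p * (a - b)) :=
      mul_le_mul_of_nonneg_left ih (hb.trans hab)
    have h3 : b ^ (p + 1) * (a - b) ≤ a ^ (p + 1) * (a - b) :=
      mul_le_mul_of_nonneg_right h1 (by linarith)
    push_cast
    calc a ^ (p + 1 + 1) - b ^ (p + 1 + 1)
        = a * (a ^ (p + 1) - b ^ (p + 1)) + b ^ (p + 1) * (a - b) := by ring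
      _ ≤ a * ((p + 1) * a ^ p * (a - b)) + a ^ (p + 1) * (a - b) := by linarith
      _ = _ := by ring

theorem tendsto_one_add_log : Tendsto (fun t : ℕ => 1 + Real.log ((t : ℝ) + 1)) atTop atTop :=
  tendsto_atTop_add_const_left _ _ (Real.tendsto_log_atTop.comp
    (tendsto_atTop_add_const_right _ _ tendsto_natCast_atTop_atTop))

theorem le_sum_scale_of_zero (p q₀ : ℕ) :
    ∃ c : ℝ, 0 < c ∧ ∀ᶠ t : ℕ in atTop,
      c * scale 0 (p + 1) t ≤ ∑ q ∈ Finset.Ico q₀ t, scale (-1) p q := by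
  set l : ℕ → ℝ := fun n => 1 + Real.log ((n : ℝ) + 1) with hl
  have hl1 : ∀ n, 1 ≤ l n := one_le_one_add_log
  -- The sum dominates a telescoping one, by comparing the increments of `l ^ (p + 1)`.
  have step : ∀ q : ℕ, l (q + 1) ^ (p + 1) - l q ^ (p + 1) ≤
      (p + 1) * 2 ^ p * scale (-1) p q := by
    intro q
    have hq : (0 : ℝ) < (q : ℝ) + 1 := by positivity
    have hinc : l (q + 1) - l q ≤ ((q : ℝ) + 1)⁻¹ := by
      have h1 : Real.log (((q : ℝ) + 1 + 1) / ((q : ℝ) + 1)) ≤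
          ((q : ℝ) + 1 + 1) / ((q : ℝ) + 1) - 1 := Real.log_le_sub_one_of_pos (by positivity)
      rw [Real.log_div (by positivity) hq.ne'] at h1
      have h2 : ((q : ℝ) + 1 + 1) / ((q : ℝ) + 1) - 1 = ((q : ℝ) + 1)⁻¹ := by field_simp; ring
      simp only [hl]
      push_cast
      linarith
    have hmono : l q ≤ l (q + 1) := one_add_log_mono (Nat.le_succ q)
    have hdouble : l (q + 1) ≤ 2 * l q := by
      have : ((q : ℝ) + 1)⁻¹ ≤ 1 := inv_le_one_of_one_le₀ (by
        have := q.cast_nonneg (α := ℝ); linarith)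
      linarith [hl1 q]
    have h0 := hl1 q
    calc l (q + 1) ^ (p + 1) - l q ^ (p + 1)
        ≤ (p + 1) * l (q + 1) ^ p * (l (q + 1) - l q) :=
          pow_succ_sub_pow_succ_le (by linarith) hmono p
      _ ≤ (p + 1) * (2 * l q) ^ p * ((q : ℝ) + 1)⁻¹ := by
          have : 0 ≤ l (q + 1) := by linarith
          have : 0 ≤ l (q + 1) - l q := by linarith
          gcongr
      _ = (p + 1) * 2 ^ p * scale (-1) p q := by
          unfold scale
          rw [Real.rpow_neg_one, mul_pow]
          ring
  refine ⟨(((p : ℝ) + 1) * 2 ^ p)⁻¹ / 2, by positivity, ?_⟩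
  have hev := ((tendsto_pow_atTop (α := ℝ) (Nat.succ_ne_zero p)).comp
    tendsto_one_add_log).eventually_ge_atTop (2 * l q₀ ^ (p + 1))
  filter_upwards [hev, eventually_ge_atTop q₀] with t ht htq
  simp only [Function.comp, Nat.succ_eq_add_one] at ht
  have hsum := Finset.sum_le_sum (s := Finset.Ico q₀ t) fun q _ => step q
  rw [Finset.sum_Ico_sub (fun q => l q ^ (p + 1)) htq, ← Finset.mul_sum] at hsum
  have hK : (0 : ℝ) < (p + 1) * 2 ^ p := by positivity
  have hs : scale 0 (p + 1) t = l t ^ (p + 1) := by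
    unfold scale
    rw [Real.rpow_zero, one_mul]
  rw [hs, div_mul_eq_mul_div, inv_mul_eq_div, div_div, div_le_iff₀ (by positivity)]
  have ht' : 2 * l q₀ ^ (p + 1) ≤ l t ^ (p + 1) := ht
  linarith

theorem le_sum_scale (x : ℝ) (p q₀ : ℕ) :
    ∃ c : ℝ, 0 < c ∧ ∀ᶠ t : ℕ in atTop, c ≤ ∑ q ∈ Finset.Ico q₀ t, scale x p q := by
  refine ⟨scale x p q₀, scale_pos _ _ _, ?_⟩
  filter_upwards [eventually_gt_atTop q₀] with t ht
  exact Finset.single_le_sum (f := fun q => scale x p q) (fun q _ => (scale_pos _ _ _).le)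
    (Finset.mem_Ico.mpr ⟨le_rfl, ht⟩)

/-! ### Sums over increasing tuples -/

/-- The tuples `q 0 < q 1 < ⋯ < q (k - 1) < t`. -/
def increasingTuples (k t : ℕ) : Finset (Fin k → ℕ) :=
  (Fintype.piFinset fun _ => Finset.range t).filter fun q => ∀ i j, i < j → q i < q j

theorem mem_increasingTuples {k t : ℕ} {q : Fin k → ℕ} :
    q ∈ increasingTuples k t ↔ (∀ i, q i < t) ∧ StrictMono q := by
  simp only [increasingTuples, Finset.mem_filter, Fintype.mem_piFinset, Finset.mem_range]
  exact Iff.rfl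

/-- The sum of `∏ (q i + 1) ^ b i` over the tuples `q 0 < ⋯ < q (k - 1) < t`. -/
noncomputable def orderedSum {k : ℕ} (b : Fin k → ℝ) (t : ℕ) : ℝ :=
  ∑ q ∈ increasingTuples k t, ∏ i, ((q i : ℝ) + 1) ^ b i

theorem orderedSum_succ {k : ℕ} (b : Fin (k + 1) → ℝ) (t : ℕ) :
    orderedSum b t = ∑ n ∈ Finset.range t,
      ((n : ℝ) + 1) ^ b (Fin.last k) * orderedSum (fun i => b i.castSucc) n := by
  simp only [orderedSum, Finset.mul_sum]
  rw [Finset.sum_sigma']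
  refine Finset.sum_bij' (fun q _ => ⟨q (Fin.last k), fun i => q i.castSucc⟩)
    (fun p _ => Fin.snoc (α := fun _ => ℕ) p.2 p.1) ?_ ?_ ?_ ?_ ?_
  · intro q hq
    rw [mem_increasingTuples] at hq
    simp only [Finset.mem_sigma, Finset.mem_range, mem_increasingTuples]
    exact ⟨hq.1 _, fun i => hq.2 (Fin.castSucc_lt_last i),
      fun i j h => hq.2 (Fin.castSucc_lt_castSucc_iff.mpr h)⟩
  · intro p hp
    simp only [Finset.mem_sigma, Finset.mem_range, mem_increasingTuples] at hp
    rw [mem_increasingTuples]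
    refine ⟨fun i => ?_, fun i j hij => ?_⟩
    · induction i using Fin.lastCases with
      | last => simpa using hp.1
      | cast i => simpa using (hp.2.1 i).trans hp.1
    · induction j using Fin.lastCases with
      | last =>
        induction i using Fin.lastCases with
        | last => exact absurd hij (lt_irrefl _)
        | cast i => simpa using hp.2.1 i
      | cast j =>
        induction i using Fin.lastCases with
        | last => exact absurd hij (not_lt.mpr (Fin.le_last _))
        | cast i => simpa using hp.2.2 (Fin.castSucc_lt_castSucc_iff.mp hij)
  · intro q hq
    ext i
    induction i using Fin.lastCases <;> simp
  · rintro ⟨n, p⟩ hp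
    simp
  · intro q hq
    rw [Fin.prod_univ_castSucc, mul_comm]

/-- The exponent `∑_{i ≥ s} (b i + 1)` contributed by the tuples whose first `s` entries are
bounded and whose other entries are of order `t`. -/
noncomputable def tailWeight {k : ℕ} (b : Fin k → ℝ) (s : Fin (k + 1)) : ℝ :=
  ∑ i ∈ Finset.univ.filter (fun i : Fin k => (s : ℕ) ≤ i), (b i + 1)

/-- The largest of the exponents `tailWeight b s`. -/
noncomputable def maxTail {k : ℕ} (b : Fin k → ℝ) : ℝ :=
  Finset.univ.sup' Finset.univ_nonempty (tailWeight b)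

open Classical in
/-- The number of `s` at which `tailWeight b s` is largest. -/
noncomputable def numMaxTail {k : ℕ} (b : Fin k → ℝ) : ℕ :=
  (Finset.univ.filter fun s => tailWeight b s = maxTail b).card

theorem tailWeight_castSucc {k : ℕ} (b : Fin (k + 1) → ℝ) (s : Fin (k + 1)) :
    tailWeight b s.castSucc = tailWeight (fun i => b i.castSucc) s + (b (Fin.last k) + 1) := by
  unfold tailWeight
  rw [Finset.sum_filter, Finset.sum_filter, Fin.sum_univ_castSucc]
  have : (s : ℕ) ≤ k := by omega
  simp [this]

theorem tailWeight_last {k : ℕ} (b : Fin k → ℝ) : tailWeight b (Fin.last k) = 0 := by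
  unfold tailWeight
  rw [Finset.filter_false_of_mem, Finset.sum_empty]
  intro i _
  simp

theorem tailWeight_le_maxTail {k : ℕ} (b : Fin k → ℝ) (s : Fin (k + 1)) :
    tailWeight b s ≤ maxTail b :=
  Finset.le_sup' (tailWeight b) (Finset.mem_univ s)

theorem exists_tailWeight_eq {k : ℕ} (b : Fin k → ℝ) : ∃ s, tailWeight b s = maxTail b := by
  obtain ⟨s, _, hs⟩ := Finset.exists_mem_eq_sup' Finset.univ_nonempty (tailWeight b)
  exact ⟨s, hs.symm⟩

theorem numMaxTail_pos {k : ℕ} (b : Fin k → ℝ) : 0 < numMaxTail b := by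
  obtain ⟨s, hs⟩ := exists_tailWeight_eq b
  exact Finset.card_pos.mpr ⟨s, by simpa using hs⟩

theorem maxTail_succ {k : ℕ} (b : Fin (k + 1) → ℝ) :
    maxTail b = max (maxTail (fun i => b i.castSucc) + (b (Fin.last k) + 1)) 0 := by
  apply le_antisymm
  · refine Finset.sup'_le _ _ fun s _ => ?_
    induction s using Fin.lastCases with
    | last => rw [tailWeight_last]; exact le_max_right _ _
    | cast s =>
      rw [tailWeight_castSucc]
      refine le_max_of_le_left ?_
      linarith [tailWeight_le_maxTail (fun i => b i.castSucc) s]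
  · refine max_le ?_ ?_
    · obtain ⟨s, hs⟩ := exists_tailWeight_eq fun i => b i.castSucc
      rw [← hs, ← tailWeight_castSucc]
      exact tailWeight_le_maxTail _ _
    · rw [← tailWeight_last b]
      exact tailWeight_le_maxTail _ _

theorem numMaxTail_succ {k : ℕ} (b : Fin (k + 1) → ℝ) :
    numMaxTail b =
      (if 0 ≤ maxTail (fun i => b i.castSucc) + (b (Fin.last k) + 1) then
        numMaxTail (fun i => b i.castSucc) else 0) +
      (if maxTail (fun i => b i.castSucc) + (b (Fin.last k) + 1) ≤ 0 then 1 else 0) := by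
  unfold numMaxTail
  rw [Finset.card_filter, Finset.card_filter, Fin.sum_univ_castSucc]
  simp only [tailWeight_castSucc, tailWeight_last]
  set x := b (Fin.last k) + 1
  set M := maxTail (fun i => b i.castSucc)
  rw [maxTail_succ]
  change _ + (if 0 = max (M + x) 0 then 1 else 0) = _
  congr 1
  · split_ifs with h
    · rw [max_eq_left h]
      simp
    · refine Finset.sum_eq_zero fun s _ => if_neg ?_
      have := tailWeight_le_maxTail (fun i => b i.castSucc) s
      rw [max_eq_right (not_le.mp h).le]
      intro h'
      apply h
      have h3 : tailWeight (fun i => b i.castSucc) s ≤ M := this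
      linarith
  · simp only [eq_comm (a := (0 : ℝ)), max_eq_right_iff]

/-- Summing the recursion for `orderedSum` over the largest entry multiplies the scale by a power,
adds a logarithm, or gives a convergent series, according to the sign of the new exponent. -/
theorem orderedSum_bounds {k : ℕ} (b : Fin k → ℝ) :
    (∃ C : ℝ, 0 < C ∧ ∀ t : ℕ, orderedSum b t ≤ C * scale (maxTail b) (numMaxTail b - 1) t) ∧
    (∃ c : ℝ, 0 < c ∧ ∀ᶠ t : ℕ in atTop,
      c * scale (maxTail b) (numMaxTail b - 1) t ≤ orderedSum b t) := by
  induction k with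
  | zero =>
    have h1 : ∀ t, orderedSum b t = 1 := by
      intro t
      simp [orderedSum, increasingTuples]
    have h2 : maxTail b = 0 := by
      obtain ⟨s, hs⟩ := exists_tailWeight_eq b
      rw [← hs, ← tailWeight_last b]
      congr
      exact Subsingleton.elim (α := Fin 1) _ _
    have h3 : numMaxTail b - 1 = 0 := by
      have : numMaxTail b ≤ 1 := (Finset.card_le_univ _).trans (by simp)
      omega
    have h4 : ∀ t, scale 0 0 t = 1 := by simp [scale]
    simp only [h1, h2, h3, h4]
    exact ⟨⟨1, one_pos, fun _ => by simp⟩, ⟨1, one_pos, Eventually.of_forall fun _ => by simp⟩⟩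
  | succ k ih =>
    set b' : Fin k → ℝ := fun i => b i.castSucc with hb'
    obtain ⟨⟨C, hC, hup⟩, ⟨c, hc, hlow⟩⟩ := ih b'
    set M' := maxTail b' with hM'
    set r' := numMaxTail b' with hr'
    have hr'pos : 0 < r' := numMaxTail_pos b'
    obtain ⟨q₀, hq₀⟩ := eventually_atTop.mp hlow
    set x := M' + (b (Fin.last k) + 1) with hx
    have hM : maxTail b = max x 0 := maxTail_succ b
    have hr : numMaxTail b = (if 0 ≤ x then r' else 0) + (if x ≤ 0 then 1 else 0) :=
      numMaxTail_succ b
    have hexp : b (Fin.last k) + M' = x - 1 := by rw [hx]; ring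
    have hU : ∀ t, orderedSum b t ≤ C * ∑ n ∈ Finset.range t, scale (x - 1) (r' - 1) n := by
      intro t
      rw [orderedSum_succ, Finset.mul_sum]
      refine Finset.sum_le_sum fun n _ => ?_
      rw [← hexp, ← mul_scale, mul_left_comm]
      exact mul_le_mul_of_nonneg_left (hup n) (by positivity)
    have hL : ∀ t, c * ∑ n ∈ Finset.Ico q₀ t, scale (x - 1) (r' - 1) n ≤ orderedSum b t := by
      intro t
      rw [orderedSum_succ, Finset.mul_sum]
      refine le_trans (Finset.sum_le_sum (g := fun n : ℕ =>
        ((n : ℝ) + 1) ^ b (Fin.last k) * orderedSum b' n) fun n hn => ?_) ?_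
      · rw [← hexp, ← mul_scale, mul_left_comm]
        exact mul_le_mul_of_nonneg_left (hq₀ n (Finset.mem_Ico.mp hn).1) (by positivity)
      · refine Finset.sum_le_sum_of_subset_of_nonneg ?_ fun n _ _ => ?_
        · intro n hn
          exact Finset.mem_range.mpr (Finset.mem_Ico.mp hn).2
        · unfold orderedSum
          positivity
    suffices hS : (∃ D : ℝ, 0 < D ∧ ∀ t, ∑ n ∈ Finset.range t, scale (x - 1) (r' - 1) n ≤
          D * scale (maxTail b) (numMaxTail b - 1) t) ∧
        (∃ d : ℝ, 0 < d ∧ ∀ᶠ t in atTop, d * scale (maxTail b) (numMaxTail b - 1) t ≤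
          ∑ n ∈ Finset.Ico q₀ t, scale (x - 1) (r' - 1) n) by
      obtain ⟨⟨D, hD, hD'⟩, ⟨d, hd, hd'⟩⟩ := hS
      refine ⟨⟨C * D, mul_pos hC hD, fun t => ?_⟩, ⟨c * d, mul_pos hc hd, ?_⟩⟩
      · rw [mul_assoc]
        exact (hU t).trans (mul_le_mul_of_nonneg_left (hD' t) hC.le)
      · filter_upwards [hd'] with t ht
        rw [mul_assoc]
        exact (mul_le_mul_of_nonneg_left ht hc.le).trans (hL t)
    rcases lt_trichotomy x 0 with hx0 | hx0 | hx0
    · have h1 : maxTail b = 0 := by rw [hM, max_eq_right hx0.le]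
      have h2 : numMaxTail b - 1 = 0 := by
        rw [hr, if_neg (not_le.mpr hx0), if_pos hx0.le]
      have h4 : ∀ t, scale 0 0 t = 1 := by simp [scale]
      simp only [h1, h2, h4, mul_one]
      exact ⟨sum_scale_le_of_neg hx0 _, le_sum_scale _ _ _⟩
    · have h1 : maxTail b = 0 := by rw [hM, hx0, max_self]
      have h2 : numMaxTail b - 1 = (r' - 1) + 1 := by
        rw [hr, if_pos hx0.ge, if_pos hx0.le]
        omega
      rw [h1, h2, hx0, zero_sub]
      exact ⟨⟨1, one_pos, fun t => by rw [one_mul]; exact sum_scale_le_of_zero _ t⟩,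
        le_sum_scale_of_zero _ _⟩
    · have h1 : maxTail b = x := by rw [hM, max_eq_left hx0.le]
      have h2 : numMaxTail b - 1 = r' - 1 := by
        rw [hr, if_pos hx0.le, if_neg (not_le.mpr hx0), add_zero]
      rw [h1, h2]
      exact ⟨sum_scale_le_of_pos hx0 _, le_sum_scale_of_pos hx0 _ _⟩

/-! ### One step of the attachment process -/

/-- The denominator of the attachment probabilities of edge number `N`. -/
noncomputable def denom (m : ℕ) (δ : ℝ) (N : ℕ) : ℝ :=
  2 * (m : ℝ) * ((N / m : ℕ) : ℝ) + ((N % m : ℕ) : ℝ) + (((N / m : ℕ) : ℝ) + 1) * δ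

/-- The number of edges of `G` that end at `w`. -/
def inCount {m N : ℕ} (G : Attachments m N) (w : ℕ) : ℕ :=
  (Finset.univ.filter fun e : Fin N => (G e : ℕ) = w).card

/-- The degree of `w` plus `δ`, where a vertex `w ≥ 1` is credited with all its `m` outgoing edges
from the start.  For the vertices that can receive an edge this is the weight with which they do;
the weight of the vertices that are still to come is `m + δ`. -/
noncomputable def weight {m N : ℕ} (δ : ℝ) (G : Attachments m N) (w : ℕ) : ℝ :=
  δ + (if w = 0 then 0 else (m : ℝ)) + inCount G w

theorem inCount_snoc {m N : ℕ} (G : Attachments m N) (i : Fin (source m N)) (w : ℕ) :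
    inCount (Fin.snoc (α := fun e : Fin (N + 1) => Fin (source m e)) G i : Attachments m (N + 1)) w
      = inCount G w + if (i : ℕ) = w then 1 else 0 := by
  unfold inCount
  rw [Finset.card_filter, Finset.card_filter, Fin.sum_univ_castSucc]
  simp

theorem card_source_eq {m N i : ℕ} (hm : 1 ≤ m) (hi : i < source m N) :
    (Finset.univ.filter fun e : Fin N => source m e = i).card = if i = 0 then 0 else m := by
  split_ifs with h0
  · rw [Finset.card_eq_zero, Finset.filter_eq_empty_iff]
    intro e _
    simp [source, h0]
  · rw [Finset.card_filter, Fin.sum_univ_eq_sum_range (fun e => if source m e = i then 1 else 0),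
      ← Finset.card_filter]
    obtain ⟨k, rfl⟩ : ∃ k, i = k + 1 := ⟨i - 1, by omega⟩
    have hk : (k + 1) * m ≤ N := (Nat.le_div_iff_mul_le (by omega)).mp (Nat.lt_succ_iff.mp hi)
    have : (Finset.range N).filter (fun e => source m e = k + 1) =
        Finset.Ico (k * m) ((k + 1) * m) := by
      ext e
      simp only [Finset.mem_filter, Finset.mem_range, Finset.mem_Ico, source, Nat.succ_inj]
      rw [← Nat.le_div_iff_mul_le (by omega : 0 < m), ← Nat.div_lt_iff_lt_mul (by omega : 0 < m)]
      constructor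
      · rintro ⟨_, h⟩
        omega
      · rintro ⟨h1, h2⟩
        refine ⟨lt_of_lt_of_le ?_ hk, by omega⟩
        rwa [← Nat.div_lt_iff_lt_mul (by omega : 0 < m)]
    rw [this, Nat.card_Ico, add_mul, one_mul, Nat.add_sub_cancel_left]

theorem weight_eq_degree {m N : ℕ} (hm : 1 ≤ m) (δ : ℝ) (G : Attachments m N) {i : ℕ}
    (hi : i < source m N) : weight δ G i = degree G i + δ := by
  unfold weight degree inCount
  rw [card_source_eq hm hi]
  push_cast
  ring

theorem attachProb_eq {m N : ℕ} (hm : 1 ≤ m) (δ : ℝ) (G : Attachments m N)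
    {i : ℕ} (hi : i < source m N) : attachProb δ G i = weight δ G i / denom m δ N := by
  rw [weight_eq_degree hm δ G hi]
  rfl

theorem sum_weight {m N : ℕ} (hm : 1 ≤ m) (δ : ℝ) (G : Attachments m N) :
    ∑ i : Fin (source m N), weight δ G i = denom m δ N := by
  rw [Finset.sum_congr rfl fun i _ => weight_eq_degree hm δ G i.isLt,
    Finset.sum_add_distrib, ← Nat.cast_sum, sum_degree hm G,
    Finset.sum_const, Finset.card_univ, Fintype.card_fin, nsmul_eq_mul]
  simp only [source, denom]
  push_cast
  ring

theorem weight_pos {m N : ℕ} {δ : ℝ} (hm : 1 ≤ m) (hδ : -(m : ℝ) < δ) (hN : m ≤ N)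
    (G : Attachments m N) (i : Fin (source m N)) : 0 < weight δ G i := by
  rw [weight_eq_degree hm δ G i.isLt]
  have : (m : ℝ) ≤ degree G i := by exact_mod_cast le_degree hm hN G i
  linarith

theorem denom_pos {m N : ℕ} {δ : ℝ} (hm : 1 ≤ m) (hδ : -(m : ℝ) < δ) (hN : m ≤ N) :
    0 < denom m δ N := by
  rw [← sum_weight hm δ (fun e => ⟨0, Nat.succ_pos _⟩ : Attachments m N)]
  exact Finset.sum_pos (fun i _ => weight_pos hm hδ hN _ i) ⟨⟨0, Nat.succ_pos _⟩, Finset.mem_univ _⟩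

theorem toReal_attachLaw {m N : ℕ} {δ : ℝ} (hm : 1 ≤ m) (hδ : -(m : ℝ) < δ) (hN : m ≤ N)
    (G : Attachments m N) (i : Fin (source m N)) :
    (attachLaw hm hδ G i).toReal = weight δ G i / denom m δ N := by
  unfold attachLaw
  rw [dif_pos hN, PMF.ofFintype_apply, ENNReal.toReal_ofReal, attachProb_eq hm δ G i.isLt]
  rw [attachProb_eq hm δ G i.isLt]
  exact (div_pos (weight_pos hm hδ hN G i) (denom_pos hm hδ hN)).le

/-- The expectation of `φ` after `N` edges, written as a finite sum. -/
noncomputable def expect {m : ℕ} {δ : ℝ} (hm : 1 ≤ m) (hδ : -(m : ℝ) < δ) (N : ℕ)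
    (φ : Attachments m N → ℝ) : ℝ :=
  ∑ G, (edgeProcess hm hδ N G).toReal * φ G

section expect

variable {m : ℕ} {δ : ℝ} (hm : 1 ≤ m) (hδ : -(m : ℝ) < δ)

theorem expect_mono {N : ℕ} {φ ψ : Attachments m N → ℝ} (h : ∀ G, φ G ≤ ψ G) :
    expect hm hδ N φ ≤ expect hm hδ N ψ :=
  Finset.sum_le_sum fun G _ => mul_le_mul_of_nonneg_left (h G) ENNReal.toReal_nonneg

theorem expect_sum {N : ℕ} {ι : Type*} (s : Finset ι) (φ : ι → Attachments m N → ℝ) :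
    expect hm hδ N (fun G => ∑ i ∈ s, φ i G) = ∑ i ∈ s, expect hm hδ N (φ i) := by
  simp only [expect, Finset.mul_sum]
  exact Finset.sum_comm

theorem expect_mul_const {N : ℕ} (φ : Attachments m N → ℝ) (c : ℝ) :
    expect hm hδ N (fun G => φ G * c) = expect hm hδ N φ * c := by
  simp only [expect, Finset.sum_mul, mul_assoc]

theorem expect_const {N : ℕ} (c : ℝ) : expect hm hδ N (fun _ => c) = c := by
  unfold expect
  rw [← Finset.sum_mul, ← ENNReal.toReal_sum fun G _ => PMF.apply_ne_top _ _,
    ← tsum_fintype (L := .unconditional _),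
    PMF.tsum_coe, ENNReal.toReal_one, one_mul]

theorem expect_succ {N : ℕ} (hN : m ≤ N) (φ : Attachments m (N + 1) → ℝ) :
    expect hm hδ (N + 1) φ = expect hm hδ N fun G => ∑ i : Fin (source m N),
      weight δ G i / denom m δ N *
        φ (Fin.snoc (α := fun e : Fin (N + 1) => Fin (source m e)) G i) := by
  classical
  have h1 : ∀ G', (edgeProcess hm hδ (N + 1) G').toReal =
      ∑ G, (edgeProcess hm hδ N G).toReal * ∑ i : Fin (source m N),
        weight δ G i / denom m δ N *
        if G' = Fin.snoc (α := fun e : Fin (N + 1) => Fin (source m e)) G i then 1 else 0 := by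
    intro G'
    rw [edgeProcess, PMF.bind_apply, tsum_fintype, ENNReal.toReal_sum]
    · refine Finset.sum_congr rfl fun G _ => ?_
      rw [ENNReal.toReal_mul, PMF.bind_apply, tsum_fintype, ENNReal.toReal_sum]
      · congr 1
        refine Finset.sum_congr rfl fun i _ => ?_
        rw [ENNReal.toReal_mul, toReal_attachLaw hm hδ hN, PMF.pure_apply]
        congr 1
        split_ifs <;> simp
      · exact fun i _ => ENNReal.mul_ne_top (PMF.apply_ne_top _ _) (PMF.apply_ne_top _ _)
    · exact fun i _ => ENNReal.mul_ne_top (PMF.apply_ne_top _ _) (PMF.apply_ne_top _ _)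
  unfold expect
  simp only [h1, Finset.sum_mul]
  rw [Finset.sum_comm]
  refine Finset.sum_congr rfl fun G _ => ?_
  simp only [mul_assoc, ← Finset.mul_sum]
  congr 1
  simp only [Finset.sum_mul]
  rw [Finset.sum_comm]
  refine Finset.sum_congr rfl fun i _ => ?_
  simp only [mul_assoc, ← Finset.mul_sum]
  simp

end expect

/-! ### The exact probability of a prescribed set of attachments -/

/-- The rising factorial `y (y + 1) ⋯ (y + a - 1)`. -/
noncomputable def rising (y : ℝ) (a : ℕ) : ℝ := ∏ j ∈ Finset.range a, (y + j)

theorem rising_succ (y : ℝ) (a : ℕ) : rising y (a + 1) = rising y a * (y + a) :=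
  Finset.prod_range_succ _ _

theorem mul_rising_add_one (y : ℝ) (a : ℕ) : y * rising (y + 1) a = rising y (a + 1) := by
  unfold rising
  rw [Finset.prod_range_succ', mul_comm]
  simp only [Nat.cast_zero, add_zero]
  congr 1
  refine Finset.prod_congr rfl fun j _ => ?_
  push_cast
  ring

theorem mul_prod_rising_update {T i : ℕ} (hi : i < T) (Y : ℕ → ℝ) (a : ℕ → ℕ) :
    Y i * ∏ w ∈ Finset.range T, rising (Y w + if i = w then 1 else 0) (a w) =
      ∏ w ∈ Finset.range T, rising (Y w) (a w + if i = w then 1 else 0) := by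
  have h : Y i = ∏ w ∈ Finset.range T, if i = w then Y w else 1 := by
    rw [Finset.prod_ite_eq, if_pos (Finset.mem_range.mpr hi)]
  conv_lhs => rw [h]
  rw [← Finset.prod_mul_distrib]
  refine Finset.prod_congr rfl fun w _ => ?_
  split_ifs
  · rw [mul_rising_add_one]
  · simp

theorem prod_rising_succ {T i : ℕ} (hi : i < T) (Y : ℕ → ℝ) (a : ℕ → ℕ) :
    ∏ w ∈ Finset.range T, rising (Y w) (a w + if i = w then 1 else 0) =
      (Y i + a i) * ∏ w ∈ Finset.range T, rising (Y w) (a w) := by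
  have h : Y i + a i = ∏ w ∈ Finset.range T, if i = w then Y w + a w else 1 := by
    rw [Finset.prod_ite_eq, if_pos (Finset.mem_range.mpr hi)]
  conv_rhs => rw [h]
  rw [← Finset.prod_mul_distrib]
  refine Finset.prod_congr rfl fun w _ => ?_
  split_ifs
  · rw [rising_succ, mul_comm]
  · simp

section prescribed

variable {E : Type*} (g u : E → ℕ)

/-- The attachments in `G` of the edges numbered `g e` that are already present are the prescribed
ones, to the vertices `u e`. -/
def Agrees {m N : ℕ} (G : Attachments m N) : Prop :=
  ∀ e, ∀ h : g e < N, (G ⟨g e, h⟩ : ℕ) = u e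

variable {g u} in
theorem agrees_snoc {m N : ℕ} (G : Attachments m N) (i : Fin (source m N)) :
    Agrees g u (Fin.snoc (α := fun e : Fin (N + 1) => Fin (source m e)) G i :
      Attachments m (N + 1)) ↔ Agrees g u G ∧ ∀ e, g e = N → (i : ℕ) = u e := by
  have hlast : ∀ (n : ℕ) (h : n < N + 1), n = N →
      (((Fin.snoc (α := fun e : Fin (N + 1) => Fin (source m e)) G i :
        Attachments m (N + 1)) ⟨n, h⟩ : ℕ)) = i := by
    rintro n h rfl
    have := Fin.snoc_last (α := fun e : Fin (n + 1) => Fin (source m e)) i G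
    exact congrArg Fin.val this
  have hcast : ∀ (n : ℕ) (h : n < N),
      (((Fin.snoc (α := fun e : Fin (N + 1) => Fin (source m e)) G i :
        Attachments m (N + 1)) ⟨n, h.trans (Nat.lt_succ_self N)⟩ : ℕ)) = G ⟨n, h⟩ := by
    intro n h
    have := Fin.snoc_castSucc (α := fun e : Fin (N + 1) => Fin (source m e)) i G ⟨n, h⟩
    exact congrArg Fin.val this
  constructor
  · intro h
    refine ⟨fun e he => ?_, fun e he => ?_⟩
    · rw [← hcast _ he]
      exact h e _
    · rw [← hlast (g e) (by omega) he]
      exact h e _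
  · rintro ⟨h1, h2⟩ e he
    rcases Nat.lt_succ_iff_lt_or_eq.mp he with h | h
    · rw [hcast _ h]
      exact h1 e h
    · rw [hlast _ he h]
      exact h2 e h

variable [Fintype E]

/-- The number of prescribed edges with end point `w` among the edges numbered `N` or later. -/
def remaining (N w : ℕ) : ℕ := (Finset.univ.filter fun e => N ≤ g e ∧ u e = w).card

/-- The number of prescribed edges later than edge number `N` whose end point exists when edge
number `N` is attached. -/
def numActive (m N : ℕ) : ℕ := (Finset.univ.filter fun e => N < g e ∧ u e < source m N).card

open Classical in
/-- The factor that edge number `N` contributes to the probability of the prescribed attachments. -/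
noncomputable def stepFactor (m : ℕ) (δ : ℝ) (N : ℕ) : ℝ :=
  if ∃ e, g e = N then (denom m δ N)⁻¹ else 1 + numActive g u m N / denom m δ N

open Classical in
/-- The product of the rising factorials of the weights, each with as many factors as there are
prescribed attachments to come, on the event that the earlier prescribed attachments took place.
Up to deterministic factors this is a martingale. -/
noncomputable def pending {m : ℕ} (δ : ℝ) (T : ℕ) {N : ℕ} (G : Attachments m N) : ℝ :=
  (if Agrees g u G then 1 else 0) *
    ∏ w ∈ Finset.range T, rising (weight δ G w) (remaining g u N w)

variable {g u}

theorem sum_remaining (m N : ℕ) :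
    ∑ i : Fin (source m N), remaining g u (N + 1) i = numActive g u m N := by
  rw [Fin.sum_univ_eq_sum_range (fun i => remaining g u (N + 1) i)]
  unfold numActive
  rw [Finset.card_eq_sum_card_fiberwise (f := u) (t := Finset.range (source m N))]
  · refine Finset.sum_congr rfl fun i hi => congrArg Finset.card ?_
    ext e
    simp only [Finset.mem_filter, Finset.mem_univ, true_and, Finset.mem_range] at hi ⊢
    constructor
    · rintro ⟨h1, h2⟩
      exact ⟨⟨h1, h2 ▸ hi⟩, h2⟩
    · rintro ⟨⟨h1, _⟩, h2⟩
      exact ⟨h1, h2⟩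
  · intro e he
    simp only [Finset.coe_filter, Finset.mem_univ, true_and, Set.mem_ofPred_eq] at he
    simpa using he.2

theorem remaining_of_ne {N : ℕ} (hN : ∀ e, g e ≠ N) (w : ℕ) :
    remaining g u N w = remaining g u (N + 1) w := by
  unfold remaining
  congr 1
  ext e
  have := hN e
  simp only [Finset.mem_filter, Finset.mem_univ, true_and]
  constructor <;> rintro ⟨h1, h2⟩ <;> exact ⟨by omega, h2⟩

theorem remaining_of_eq (hg : Function.Injective g) {N : ℕ} {e₀ : E} (h0 : g e₀ = N) (w : ℕ) :
    remaining g u N w = remaining g u (N + 1) w + if u e₀ = w then 1 else 0 := by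
  classical
  unfold remaining
  rw [Finset.card_filter, Finset.card_filter]
  have : (if u e₀ = w then 1 else 0) =
      ∑ e : E, if e₀ = e then (if u e = w then 1 else 0) else 0 := by
    rw [Finset.sum_ite_eq, if_pos (Finset.mem_univ _)]
  rw [this, ← Finset.sum_add_distrib]
  refine Finset.sum_congr rfl fun e _ => ?_
  by_cases he : e₀ = e
  · subst he
    simp [h0]
  · have : g e ≠ N := fun h => he (hg (h0.trans h.symm))
    rw [if_neg he, add_zero]
    refine if_congr (and_congr_left fun _ => ?_) rfl rfl
    omega

theorem weight_snoc {m N : ℕ} (δ : ℝ) (G : Attachments m N) (i : Fin (source m N)) (w : ℕ) :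
    weight δ (Fin.snoc (α := fun e : Fin (N + 1) => Fin (source m e)) G i :
      Attachments m (N + 1)) w = weight δ G w + if (i : ℕ) = w then 1 else 0 := by
  unfold weight
  rw [inCount_snoc]
  push_cast
  ring

theorem sum_pending_snoc {m N T : ℕ} {δ : ℝ} (hm : 1 ≤ m) (hδ : -(m : ℝ) < δ) (hN : m ≤ N)
    (hT : source m N ≤ T) (hg : Function.Injective g) (hu : ∀ e, u e < source m (g e))
    (G : Attachments m N) :
    ∑ i : Fin (source m N), weight δ G i / denom m δ N *
        pending g u δ T (Fin.snoc (α := fun e : Fin (N + 1) => Fin (source m e)) G i :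
          Attachments m (N + 1)) = pending g u δ T G * stepFactor g u m δ N := by
  classical
  have hD := denom_pos hm hδ hN
  unfold pending stepFactor
  simp only [agrees_snoc, weight_snoc]
  by_cases hA : Agrees g u G
  swap
  · simp [hA]
  simp only [hA, true_and, if_true, one_mul]
  by_cases hex : ∃ e, g e = N
  · obtain ⟨e₀, h0⟩ := hex
    rw [if_pos ⟨e₀, h0⟩]
    have huN : u e₀ < source m N := h0 ▸ hu e₀
    have hiff : ∀ i : Fin (source m N), (∀ e, g e = N → (i : ℕ) = u e) ↔ i = ⟨u e₀, huN⟩ := by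
      intro i
      rw [Fin.ext_iff]
      constructor
      · exact fun h => h e₀ h0
      · intro h e he
        rw [hg (he.trans h0.symm)]
        exact h
    simp only [hiff]
    rw [Finset.sum_eq_single ⟨u e₀, huN⟩]
    · rw [if_pos rfl, one_mul, div_mul_eq_mul_div]
      rw [mul_prod_rising_update (i := u e₀) (huN.trans_le hT) (weight δ G), div_eq_mul_inv]
      simp only [remaining_of_eq hg h0]
    · intro i _ hi
      rw [if_neg hi]
      simp
    · simp
  · rw [if_neg hex]
    push Not at hex
    have hvac : ∀ i : Fin (source m N), ∀ e, g e = N → (i : ℕ) = u e :=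
      fun i e he => absurd he (hex e)
    simp only [remaining_of_ne hex]
    have hterm : ∀ i : Fin (source m N), weight δ G i / denom m δ N *
        ((if ∀ e, g e = N → (i : ℕ) = u e then 1 else 0) * ∏ w ∈ Finset.range T,
          rising (weight δ G w + if (i : ℕ) = w then 1 else 0) (remaining g u (N + 1) w)) =
        (weight δ G i + remaining g u (N + 1) i) * ((∏ w ∈ Finset.range T,
          rising (weight δ G w) (remaining g u (N + 1) w)) / denom m δ N) := by
      intro i
      rw [if_pos (hvac i), one_mul, div_mul_eq_mul_div,
        mul_prod_rising_update (i.isLt.trans_le hT) (weight δ G),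
        prod_rising_succ (i.isLt.trans_le hT) (weight δ G), mul_div_assoc]
    rw [Finset.sum_congr rfl fun i _ => hterm i, ← Finset.sum_mul, Finset.sum_add_distrib,
      sum_weight hm, ← Nat.cast_sum, sum_remaining m N]
    field_simp

theorem expect_pending {m T N : ℕ} {δ : ℝ} (hm : 1 ≤ m) (hδ : -(m : ℝ) < δ) (hN : m ≤ N)
    (hT : ∀ n < N, source m n ≤ T) (hg : Function.Injective g)
    (hu : ∀ e, u e < source m (g e)) :
    expect hm hδ N (pending g u δ T) =
      (∏ w ∈ Finset.range T, rising (m + δ) (remaining g u m w)) *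
        ∏ n ∈ Finset.Ico m N, stepFactor g u m δ n := by
  induction N, hN using Nat.le_induction with
  | base =>
    -- the first `m` edges can only go to vertex `0`
    have hsrc : ∀ n, n < m → source m n = 1 := fun n hn => by simp [source, Nat.div_eq_of_lt hn]
    have hval : ∀ (G : Attachments m m) (e : Fin m), (G e : ℕ) = 0 := by
      intro G e
      have h1 := (G e).isLt
      have h2 := hsrc e e.isLt
      omega
    have hconst : ∀ G : Attachments m m, pending g u δ T G =
        ∏ w ∈ Finset.range T, rising (m + δ) (remaining g u m w) := by
      intro G
      unfold pending
      rw [if_pos, one_mul]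
      · refine Finset.prod_congr rfl fun w _ => ?_
        congr 1
        unfold weight inCount
        simp only [hval]
        by_cases hw : w = 0
        · simp [hw, add_comm]
        · simp [hw, Ne.symm hw, add_comm]
      · intro e he
        have h1 := hu e
        rw [hsrc _ he] at h1
        rw [hval]
        omega
    rw [show pending g u δ T = fun _ => _ from funext hconst, expect_const, Finset.Ico_self,
      Finset.prod_empty, mul_one]
  | succ N hN ih =>
    rw [expect_succ hm hδ hN]
    simp only [sum_pending_snoc hm hδ hN (hT N (Nat.lt_succ_self N)) hg hu]
    rw [expect_mul_const, ih fun n hn => hT n (hn.trans (Nat.lt_succ_self N)),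
      Finset.prod_Ico_succ_top hN, mul_assoc]

open Classical in
/-- The probability of prescribed attachments is an explicit product. -/
theorem expect_agrees {m t : ℕ} {δ : ℝ} (hm : 1 ≤ m) (hδ : -(m : ℝ) < δ) (ht : 2 ≤ t)
    (hg : Function.Injective g) (hgt : ∀ e, g e < m * (t - 1))
    (hu : ∀ e, u e < source m (g e)) :
    expect hm hδ (m * (t - 1)) (fun G => if Agrees g u G then 1 else 0) =
      (∏ w ∈ Finset.range t, rising (m + δ) (remaining g u m w)) *
        ∏ n ∈ Finset.Ico m (m * (t - 1)), stepFactor g u m δ n := by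
  have hN : m ≤ m * (t - 1) := Nat.le_mul_of_pos_right _ (by omega)
  rw [← expect_pending hm hδ hN (T := t) _ hg hu]
  · congr 1
    ext G
    unfold pending
    have h0 : ∀ w, remaining g u (m * (t - 1)) w = 0 := by
      intro w
      unfold remaining
      rw [Finset.card_eq_zero, Finset.filter_eq_empty_iff]
      rintro e - ⟨h, _⟩
      exact absurd (hgt e) (not_lt.mpr h)
    simp [h0, rising]
  · intro n hn
    have : n / m < t - 1 := Nat.div_lt_of_lt_mul hn
    unfold source
    omega

end prescribed

/-! ### Growth of the normalizing constants -/

/-- The exponent `κ = 1 / (τ - 1)` with which the degree of a vertex grows. -/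
noncomputable def degreeExponent (m : ℕ) (δ : ℝ) : ℝ := m / (2 * m + δ)

section growth

variable {m : ℕ} {δ : ℝ}

theorem degreeExponent_pos (hm : 1 ≤ m) (hδ : -(m : ℝ) < δ) : 0 < degreeExponent m δ := by
  have : (1 : ℝ) ≤ m := by exact_mod_cast hm
  exact div_pos (by linarith) (by linarith)

theorem le_denom (hm : 1 ≤ m) (hδ : -(m : ℝ) < δ) {n : ℕ} (hn : m ≤ n) :
    (m + δ) / m * ((n : ℝ) + 1) ≤ denom m δ n := by
  have hm' : (1 : ℝ) ≤ m := by exact_mod_cast hm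
  have hq : (1 : ℝ) ≤ ((n / m : ℕ) : ℝ) := by
    exact_mod_cast (Nat.le_div_iff_mul_le (by omega)).mpr (by omega)
  have hn1 : (n : ℝ) + 1 ≤ m * (((n / m : ℕ) : ℝ) + 1) := by
    exact_mod_cast Nat.lt_mul_div_succ n hm
  have hr : (0 : ℝ) ≤ ((n % m : ℕ) : ℝ) := Nat.cast_nonneg _
  have h1 : (m + δ) / m * ((n : ℝ) + 1) ≤ (m + δ) * (((n / m : ℕ) : ℝ) + 1) := by
    rw [div_mul_eq_mul_div, div_le_iff₀ (by linarith)]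
    nlinarith
  unfold denom
  nlinarith

theorem abs_denom_sub_le (hm : 1 ≤ m) (δ : ℝ) (n : ℕ) :
    |denom m δ n - ((n : ℝ) + 1) / degreeExponent m δ| ≤ m + 2 + 2 * |δ| := by
  have hm' : (1 : ℝ) ≤ m := by exact_mod_cast hm
  have hn : (n : ℝ) = m * ((n / m : ℕ) : ℝ) + ((n % m : ℕ) : ℝ) := by
    exact_mod_cast (Nat.div_add_mod n m).symm
  have hr0 : (0 : ℝ) ≤ ((n % m : ℕ) : ℝ) := Nat.cast_nonneg _
  have hr1 : ((n % m : ℕ) : ℝ) + 1 ≤ m := by exact_mod_cast Nat.mod_lt n hm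
  have heq : denom m δ n - ((n : ℝ) + 1) / degreeExponent m δ =
      -((n % m : ℕ) : ℝ) - 2 + δ - (((n % m : ℕ) : ℝ) + 1) / m * δ := by
    unfold denom degreeExponent
    rw [hn]
    field_simp
    ring
  have hf0 : 0 ≤ (((n % m : ℕ) : ℝ) + 1) / m := by positivity
  have hf1 : (((n % m : ℕ) : ℝ) + 1) / m ≤ 1 := (div_le_one (by linarith)).mpr hr1
  have hf : |(((n % m : ℕ) : ℝ) + 1) / m * δ| ≤ |δ| := by
    rw [abs_mul, abs_of_nonneg hf0]
    exact mul_le_of_le_one_left (abs_nonneg _) hf1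
  rw [heq, abs_le]
  have h1 := abs_le.mp hf
  have h2 := le_abs_self δ
  have h3 := neg_abs_le δ
  constructor <;> linarith [h1.1, h1.2]

theorem denom_le (hm : 1 ≤ m) (hδ : -(m : ℝ) < δ) :
    ∃ C : ℝ, 0 < C ∧ ∀ n, denom m δ n ≤ C * ((n : ℝ) + 1) := by
  have hκ := degreeExponent_pos hm hδ
  refine ⟨(degreeExponent m δ)⁻¹ + (m + 2 + 2 * |δ|), by positivity, fun n => ?_⟩
  have h1 := (abs_le.mp (abs_denom_sub_le hm δ n)).2
  have h2 : (0 : ℝ) ≤ n := n.cast_nonneg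
  have h3 : 0 ≤ (m : ℝ) + 2 + 2 * |δ| := by positivity
  rw [div_eq_inv_mul] at h1
  nlinarith

/-- The sum of the reciprocals of the normalizing constants; it grows like `κ log N`. -/
noncomputable def recipSum (m : ℕ) (δ : ℝ) (N : ℕ) : ℝ := ∑ n ∈ Finset.Ico m N, (denom m δ n)⁻¹

theorem sum_inv_sq_le {m : ℕ} : ∃ C : ℝ, 0 < C ∧ ∀ N : ℕ,
    ∑ n ∈ Finset.Ico m N, (((n : ℝ) + 1) ^ 2)⁻¹ ≤ C := by
  have hs : Summable fun n : ℕ => (((n : ℝ) + 1) ^ 2)⁻¹ := by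
    have := (summable_nat_add_iff 1).mpr (Real.summable_nat_pow_inv (p := 2).mpr one_lt_two)
    simpa using this
  have hnn : ∀ n : ℕ, 0 ≤ (((n : ℝ) + 1) ^ 2)⁻¹ := fun n => by positivity
  refine ⟨∑' n : ℕ, (((n : ℝ) + 1) ^ 2)⁻¹ + 1, by positivity, fun N => ?_⟩
  have := hs.sum_le_tsum (Finset.Ico m N) fun n _ => hnn n
  linarith

theorem inv_denom_le (hm : 1 ≤ m) (hδ : -(m : ℝ) < δ) {n : ℕ} (hn : m ≤ n) :
    (denom m δ n)⁻¹ ≤ m / (m + δ) * ((n : ℝ) + 1)⁻¹ := by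
  have hm' : (1 : ℝ) ≤ m := by exact_mod_cast hm
  have hmδ : 0 < m + δ := by linarith
  have h : (m / (m + δ) * ((n : ℝ) + 1)⁻¹) = ((m + δ) / m * ((n : ℝ) + 1))⁻¹ := by
    rw [mul_inv, inv_div]
  rw [h]
  exact inv_anti₀ (by positivity) (le_denom hm hδ hn)

theorem abs_inv_denom_sub_log_le (hm : 1 ≤ m) (hδ : -(m : ℝ) < δ) :
    ∃ C : ℝ, 0 < C ∧ ∀ n, m ≤ n → |(denom m δ n)⁻¹ - degreeExponent m δ *
      (Real.log ((n + 1 : ℕ) + 1) - Real.log ((n : ℝ) + 1))| ≤ C * (((n : ℝ) + 1) ^ 2)⁻¹ := by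
  have hκ := degreeExponent_pos hm hδ
  set κ := degreeExponent m δ with hκdef
  have hm' : (1 : ℝ) ≤ m := by exact_mod_cast hm
  have hmδ : 0 < m + δ := by linarith
  refine ⟨m / (m + δ) * (κ * (m + 2 + 2 * |δ|)) + κ, by positivity, fun n hn => ?_⟩
  have hn0 : (0 : ℝ) < (n : ℝ) + 1 := by positivity
  have hD := denom_pos hm hδ hn
  have h1 : |(denom m δ n)⁻¹ - κ * ((n : ℝ) + 1)⁻¹| ≤
      m / (m + δ) * (κ * (m + 2 + 2 * |δ|)) * (((n : ℝ) + 1) ^ 2)⁻¹ := by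
    have heq : (denom m δ n)⁻¹ - κ * ((n : ℝ) + 1)⁻¹ =
        (denom m δ n)⁻¹ * (-(κ * (denom m δ n - ((n : ℝ) + 1) / κ)) * ((n : ℝ) + 1)⁻¹) := by
      field_simp
      ring
    rw [heq, abs_mul, abs_mul, abs_neg, abs_mul, abs_of_pos hκ, abs_of_pos (inv_pos.mpr hD),
      abs_of_pos (inv_pos.mpr hn0)]
    calc (denom m δ n)⁻¹ * (κ * |denom m δ n - ((n : ℝ) + 1) / κ| * ((n : ℝ) + 1)⁻¹)
        ≤ (m / (m + δ) * ((n : ℝ) + 1)⁻¹) *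
            (κ * (m + 2 + 2 * |δ|) * ((n : ℝ) + 1)⁻¹) := by
          have ha := inv_denom_le hm hδ hn
          have hb := abs_denom_sub_le hm δ n
          gcongr
      _ = _ := by field_simp
  have h2 : |((n : ℝ) + 1)⁻¹ - (Real.log ((n + 1 : ℕ) + 1) - Real.log ((n : ℝ) + 1))| ≤
      (((n : ℝ) + 1) ^ 2)⁻¹ := by
    have hpos : (0 : ℝ) < ((n + 1 : ℕ) : ℝ) + 1 := by positivity
    rw [← Real.log_div hpos.ne' hn0.ne']
    have hup := Real.log_le_sub_one_of_pos (div_pos hpos hn0)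
    have hlow := Real.one_sub_inv_le_log_of_pos (div_pos hpos hn0)
    have e1 : (((n + 1 : ℕ) : ℝ) + 1) / ((n : ℝ) + 1) - 1 = ((n : ℝ) + 1)⁻¹ := by
      push_cast
      field_simp
      ring
    have e2 : 1 - ((((n + 1 : ℕ) : ℝ) + 1) / ((n : ℝ) + 1))⁻¹ = ((n : ℝ) + 1 + 1)⁻¹ := by
      push_cast
      field_simp
      ring
    rw [e1] at hup
    rw [e2] at hlow
    have e3 : ((n : ℝ) + 1)⁻¹ - ((n : ℝ) + 1 + 1)⁻¹ ≤ (((n : ℝ) + 1) ^ 2)⁻¹ := by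
      have : ((n : ℝ) + 1)⁻¹ - ((n : ℝ) + 1 + 1)⁻¹ = (((n : ℝ) + 1) * ((n : ℝ) + 1 + 1))⁻¹ := by
        field_simp
        ring
      rw [this]
      refine inv_anti₀ (by positivity) ?_
      nlinarith
    rw [abs_le]
    have : 0 ≤ (((n : ℝ) + 1) ^ 2)⁻¹ := by positivity
    constructor <;> linarith
  have h3 : (denom m δ n)⁻¹ - κ * (Real.log ((n + 1 : ℕ) + 1) - Real.log ((n : ℝ) + 1)) =
      ((denom m δ n)⁻¹ - κ * ((n : ℝ) + 1)⁻¹) +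
        κ * (((n : ℝ) + 1)⁻¹ - (Real.log ((n + 1 : ℕ) + 1) - Real.log ((n : ℝ) + 1))) := by ring
  rw [h3, add_mul]
  refine (abs_add_le _ _).trans (add_le_add h1 ?_)
  rw [abs_mul, abs_of_pos hκ]
  exact mul_le_mul_of_nonneg_left h2 hκ.le

theorem abs_recipSum_sub_le (hm : 1 ≤ m) (hδ : -(m : ℝ) < δ) :
    ∃ C : ℝ, 0 < C ∧ ∀ N : ℕ,
      |recipSum m δ N - degreeExponent m δ * Real.log ((N : ℝ) + 1)| ≤ C := by
  obtain ⟨A, hA, hA'⟩ := abs_inv_denom_sub_log_le hm hδ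
  obtain ⟨B, hB, hB'⟩ := sum_inv_sq_le (m := m)
  have hκ := degreeExponent_pos hm hδ
  set κ := degreeExponent m δ with hκdef
  have hlogm : 0 ≤ Real.log ((m : ℝ) + 1) :=
    Real.log_nonneg (by have := m.cast_nonneg (α := ℝ); linarith)
  refine ⟨A * B + κ * Real.log ((m : ℝ) + 1), by positivity, fun N => ?_⟩
  rcases le_total m N with h | h
  · have hsum := Finset.abs_sum_le_sum_abs (fun n : ℕ => (denom m δ n)⁻¹ - κ *
      (Real.log ((n + 1 : ℕ) + 1) - Real.log ((n : ℝ) + 1))) (Finset.Ico m N)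
    have hle : ∑ n ∈ Finset.Ico m N, |(denom m δ n)⁻¹ - κ *
        (Real.log ((n + 1 : ℕ) + 1) - Real.log ((n : ℝ) + 1))| ≤ A * B := by
      refine (Finset.sum_le_sum fun n hn => hA' n (Finset.mem_Ico.mp hn).1).trans ?_
      rw [← Finset.mul_sum]
      exact mul_le_mul_of_nonneg_left (hB' N) hA.le
    rw [Finset.sum_sub_distrib, ← Finset.mul_sum,
      Finset.sum_Ico_sub (fun n : ℕ => Real.log ((n : ℝ) + 1)) h] at hsum
    have h1 := abs_le.mp (hsum.trans hle)
    unfold recipSum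
    rw [abs_le]
    constructor <;> nlinarith [h1.1, h1.2]
  · have h0 : recipSum m δ N = 0 := by
      unfold recipSum
      rw [Finset.Ico_eq_empty (by omega), Finset.sum_empty]
    have h1 : 0 ≤ Real.log ((N : ℝ) + 1) :=
      Real.log_nonneg (by have := N.cast_nonneg (α := ℝ); linarith)
    have h2 : Real.log ((N : ℝ) + 1) ≤ Real.log ((m : ℝ) + 1) := by
      linarith [one_add_log_mono h]
    rw [h0, zero_sub, abs_neg, abs_of_nonneg (by positivity)]
    nlinarith [mul_pos hA hB]

theorem abs_log_sub_log_le {x y c : ℝ} (hx : 0 < x) (hy : 0 < y) (hc : 1 ≤ c) (h1 : x ≤ c * y)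
    (h2 : y ≤ c * x) : |Real.log x - Real.log y| ≤ Real.log c := by
  have hc0 : 0 < c := by linarith
  have e1 := Real.log_le_log hx h1
  have e2 := Real.log_le_log hy h2
  rw [Real.log_mul hc0.ne' hy.ne'] at e1
  rw [Real.log_mul hc0.ne' hx.ne'] at e2
  rw [abs_le]
  constructor <;> linarith

/-- Between the arrival of the vertex `u` and that of edge number `n`, the sum of the reciprocals
of the normalizing constants is `κ` times the logarithm of the ratio of the two arrival times. -/
theorem abs_recipSum_sub_recipSum_le (hm : 1 ≤ m) (hδ : -(m : ℝ) < δ) :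
    ∃ C : ℝ, 0 < C ∧ ∀ n u : ℕ,
      |recipSum m δ n - recipSum m δ (m * u) - degreeExponent m δ *
        (Real.log ((source m n : ℝ) + 1) - Real.log ((u : ℝ) + 1))| ≤ C := by
  obtain ⟨A, hA, hA'⟩ := abs_recipSum_sub_le hm hδ
  have hκ := degreeExponent_pos hm hδ
  set κ := degreeExponent m δ with hκdef
  have hm' : (1 : ℝ) ≤ m := by exact_mod_cast hm
  have hlog : 0 ≤ Real.log (2 * m) := Real.log_nonneg (by linarith)
  refine ⟨2 * A + 2 * (κ * Real.log (2 * m)), by positivity, fun n u => ?_⟩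
  have h1 := abs_le.mp (hA' n)
  have h2 := abs_le.mp (hA' (m * u))
  have h3 : |Real.log ((source m n : ℝ) + 1) - Real.log ((n : ℝ) + 1)| ≤ Real.log (2 * m) := by
    refine abs_log_sub_log_le (by positivity) (by positivity) (by linarith) ?_ ?_
    · have ha : n / m + 1 + 1 ≤ 2 * m * (n + 1) := by
        have := Nat.div_le_self n m
        nlinarith
      unfold source
      exact_mod_cast ha
    · have hb : n + 1 ≤ 2 * m * (n / m + 1 + 1) := by
        have := Nat.lt_mul_div_succ n hm
        nlinarith
      unfold source
      exact_mod_cast hb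
  have h4 : |Real.log (((m * u : ℕ) : ℝ) + 1) - Real.log ((u : ℝ) + 1)| ≤ Real.log (2 * m) := by
    have hu0 : (0 : ℝ) ≤ u := u.cast_nonneg
    refine abs_log_sub_log_le (by positivity) (by positivity) (by linarith) ?_ ?_
    · push_cast
      nlinarith
    · push_cast
      have h5 : (1 : ℝ) * u ≤ m * u := mul_le_mul_of_nonneg_right hm' hu0
      nlinarith
  have h5 : |κ * (Real.log ((source m n : ℝ) + 1) - Real.log ((n : ℝ) + 1))| ≤
      κ * Real.log (2 * m) := by
    rw [abs_mul, abs_of_pos hκ]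
    exact mul_le_mul_of_nonneg_left h3 hκ.le
  have h6 : |κ * (Real.log (((m * u : ℕ) : ℝ) + 1) - Real.log ((u : ℝ) + 1))| ≤
      κ * Real.log (2 * m) := by
    rw [abs_mul, abs_of_pos hκ]
    exact mul_le_mul_of_nonneg_left h4 hκ.le
  rw [mul_sub] at h5 h6
  have h5' := abs_le.mp h5
  have h6' := abs_le.mp h6
  rw [mul_sub, abs_le]
  constructor <;> linarith [h1.1, h1.2, h2.1, h2.2, h5'.1, h5'.2, h6'.1, h6'.2]

end growth

/-! ### The order of the probability of prescribed attachments -/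

section bounds

variable {m : ℕ} {δ : ℝ}

theorem rising_bounds {y C : ℝ} (hy : 0 < y) {a K : ℕ} (ha : a ≤ K) (hC : y + K ≤ C) :
    min 1 y ^ a ≤ rising y a ∧ rising y a ≤ C ^ a := by
  have hpow : ∀ z : ℝ, z ^ a = ∏ _j ∈ Finset.range a, z := by simp
  unfold rising
  rw [hpow, hpow]
  have hmin : 0 < min 1 y := lt_min one_pos hy
  constructor
  · refine Finset.prod_le_prod (fun _ _ => hmin.le) fun j _ => ?_
    have := j.cast_nonneg (α := ℝ)
    linarith [min_le_right 1 y]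
  · refine Finset.prod_le_prod (fun j _ => by positivity) fun j hj => ?_
    have : (j : ℝ) ≤ K := by exact_mod_cast (Finset.mem_range.mp hj).le.trans ha
    linarith

variable {E : Type*} [Fintype E]

theorem sum_remaining_le (g u : E → ℕ) (N t : ℕ) :
    ∑ w ∈ Finset.range t, remaining g u N w ≤ Fintype.card E := by
  unfold remaining
  simp only [Finset.card_filter]
  rw [Finset.sum_comm, Fintype.card_eq_sum_ones]
  refine Finset.sum_le_sum fun e _ => ?_
  rw [← Finset.card_filter]
  refine Finset.card_le_one.mpr fun a ha b hb => ?_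
  simp only [Finset.mem_filter] at ha hb
  rw [← ha.2.2, ← hb.2.2]

theorem prod_rising_bounds (hδ : -(m : ℝ) < δ) :
    ∃ c C : ℝ, 0 < c ∧ 0 < C ∧ ∀ (g u : E → ℕ) (N t : ℕ),
      c ≤ ∏ w ∈ Finset.range t, rising (m + δ) (remaining g u N w) ∧
      ∏ w ∈ Finset.range t, rising (m + δ) (remaining g u N w) ≤ C := by
  have hy : 0 < m + δ := by linarith
  set K := Fintype.card E
  set y := m + δ
  set B := 1 + (y + K) with hB
  have hB1 : 1 ≤ B := by
    have : (0 : ℝ) ≤ K := Nat.cast_nonneg _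
    linarith
  have hmin : 0 < min 1 y := lt_min one_pos hy
  refine ⟨min 1 y ^ K, B ^ K, by positivity, by positivity, fun g u N t => ?_⟩
  have hsum := sum_remaining_le g u N t
  have hle : ∀ w ∈ Finset.range t, remaining g u N w ≤ K := fun w _ => Finset.card_le_univ _
  constructor
  · calc min 1 y ^ K ≤ min 1 y ^ ∑ w ∈ Finset.range t, remaining g u N w :=
          pow_le_pow_of_le_one hmin.le (min_le_left _ _) hsum
      _ = ∏ w ∈ Finset.range t, min 1 y ^ remaining g u N w :=
          (Finset.prod_pow_eq_pow_sum _ _ _).symm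
      _ ≤ _ := Finset.prod_le_prod (fun _ _ => by positivity) fun w hw =>
          (rising_bounds hy (hle w hw) (by linarith : y + K ≤ B)).1
  · calc ∏ w ∈ Finset.range t, rising y (remaining g u N w)
          ≤ ∏ w ∈ Finset.range t, B ^ remaining g u N w :=
          Finset.prod_le_prod
            (fun w hw => le_trans (by positivity)
              (rising_bounds hy (hle w hw) (by linarith : y + K ≤ B)).1) fun w hw =>
            (rising_bounds hy (hle w hw) (by linarith : y + K ≤ B)).2
      _ = B ^ ∑ w ∈ Finset.range t, remaining g u N w := Finset.prod_pow_eq_pow_sum _ _ _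
      _ ≤ B ^ K := pow_le_pow_right₀ hB1 hsum

/-- The total rate at which the prescribed end points gain weight, split over the edges. -/
theorem sum_numActive_div (hm : 1 ≤ m) {g u : E → ℕ} {N : ℕ} (hgN : ∀ e, g e < N)
    (hu : ∀ e, u e < source m (g e)) :
    ∑ n ∈ Finset.Ico m N, (numActive g u m n : ℝ) / denom m δ n =
      ∑ e, (recipSum m δ (g e) - recipSum m δ (m * u e)) := by
  have h1 : ∀ n, (numActive g u m n : ℝ) / denom m δ n =
      ∑ e, if n < g e ∧ u e < source m n then (denom m δ n)⁻¹ else 0 := by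
    intro n
    unfold numActive
    rw [Finset.card_filter]
    push_cast
    rw [div_eq_mul_inv, Finset.sum_mul]
    refine Finset.sum_congr rfl fun e _ => ?_
    split_ifs <;> simp
  simp only [h1]
  rw [Finset.sum_comm]
  refine Finset.sum_congr rfl fun e _ => ?_
  have hle : m * u e ≤ g e := by
    have := Nat.lt_succ_iff.mp (hu e)
    rw [Nat.le_div_iff_mul_le (by omega)] at this
    rwa [mul_comm]
  have hset : (Finset.Ico m N).filter (fun n => n < g e ∧ u e < source m n) =
      Finset.Ico m (g e) \ Finset.Ico m (m * u e) := by
    ext n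
    have h2 : u e < source m n ↔ m * u e ≤ n := by
      unfold source
      rw [Nat.lt_succ_iff, Nat.le_div_iff_mul_le (by omega), mul_comm]
    have h3 := hgN e
    simp only [Finset.mem_filter, Finset.mem_Ico, Finset.mem_sdiff, h2]
    omega
  rw [← Finset.sum_filter, hset]
  exact Finset.sum_sdiff_eq_sub (Finset.Ico_subset_Ico le_rfl hle)

theorem prod_one_add_bounds {ι : Type*} (s : Finset ι) {x : ι → ℝ} (hx : ∀ i ∈ s, 0 ≤ x i) :
    Real.exp (∑ i ∈ s, x i - ∑ i ∈ s, x i ^ 2) ≤ ∏ i ∈ s, (1 + x i) ∧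
      ∏ i ∈ s, (1 + x i) ≤ Real.exp (∑ i ∈ s, x i) := by
  rw [← Finset.sum_sub_distrib, Real.exp_sum, Real.exp_sum]
  constructor
  · refine Finset.prod_le_prod (fun _ _ => (Real.exp_pos _).le) fun i hi => ?_
    have h0 := hx i hi
    have hpos : 0 < 1 + x i := by linarith
    rw [← Real.le_log_iff_exp_le hpos]
    refine le_trans ?_ (Real.one_sub_inv_le_log_of_pos hpos)
    have : 1 - (1 + x i)⁻¹ = x i / (1 + x i) := by field_simp; ring
    rw [this, le_div_iff₀ hpos]
    nlinarith [pow_nonneg h0 3]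
  · refine Finset.prod_le_prod (fun i hi => by linarith [hx i hi]) fun i _ => ?_
    rw [add_comm]
    exact Real.add_one_le_exp _

open Classical in
/-- The product of the step factors, as a product of the growth factors `1 + A / denom` over all steps
and a correction for each prescribed edge. -/
theorem prod_stepFactor (hm : 1 ≤ m) (hδ : -(m : ℝ) < δ) {g u : E → ℕ}
    (hg : Function.Injective g) {N : ℕ} (hgN : ∀ e, g e < N) :
    ∏ n ∈ Finset.Ico m N, stepFactor g u m δ n =
      (∏ n ∈ Finset.Ico m N, (1 + (numActive g u m n : ℝ) / denom m δ n)) *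
        ∏ e, if m ≤ g e then
          (denom m δ (g e) * (1 + (numActive g u m (g e) : ℝ) / denom m δ (g e)))⁻¹ else 1 := by
  have h1 : ∏ e, (if m ≤ g e then
      (denom m δ (g e) * (1 + (numActive g u m (g e) : ℝ) / denom m δ (g e)))⁻¹ else 1) =
      ∏ n ∈ Finset.Ico m N, if ∃ e, g e = n then
        (denom m δ n * (1 + (numActive g u m n : ℝ) / denom m δ n))⁻¹ else 1 := by
    rw [← Finset.prod_filter, ← Finset.prod_filter,
      ← Finset.prod_image (f := fun n =>
        (denom m δ n * (1 + (numActive g u m n : ℝ) / denom m δ n))⁻¹) (g := g)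
        (fun a _ b _ h => hg h)]
    refine Finset.prod_congr ?_ fun _ _ => rfl
    ext n
    simp only [Finset.mem_image, Finset.mem_filter, Finset.mem_univ, true_and, Finset.mem_Ico]
    constructor
    · rintro ⟨e, he, rfl⟩
      exact ⟨⟨he, hgN e⟩, e, rfl⟩
    · rintro ⟨⟨h, _⟩, e, rfl⟩
      exact ⟨e, h, rfl⟩
  rw [h1, ← Finset.prod_mul_distrib]
  refine Finset.prod_congr rfl fun n hn => ?_
  have hD := denom_pos hm hδ (Finset.mem_Ico.mp hn).1
  unfold stepFactor
  split_ifs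
  · have : 0 < 1 + (numActive g u m n : ℝ) / denom m δ n := by positivity
    field_simp
  · simp

theorem numActive_div_le (hm : 1 ≤ m) (hδ : -(m : ℝ) < δ) (g u : E → ℕ) {n : ℕ} (hn : m ≤ n) :
    (numActive g u m n : ℝ) / denom m δ n ≤
      Fintype.card E * (m / (m + δ)) * ((n : ℝ) + 1)⁻¹ := by
  have hm' : (1 : ℝ) ≤ m := by exact_mod_cast hm
  have hmδ : 0 < m + δ := by linarith
  have h1 : (numActive g u m n : ℝ) ≤ Fintype.card E := by exact_mod_cast Finset.card_le_univ _
  have h2 := inv_denom_le hm hδ hn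
  have h3 := denom_pos hm hδ hn
  rw [div_eq_mul_inv, mul_assoc]
  gcongr

/-- The order of the probability that an edge from `v` goes to `u`. -/
noncomputable def edgeWeight (m : ℕ) (δ : ℝ) (v u : ℕ) : ℝ :=
  ((v : ℝ) + 1) ^ (degreeExponent m δ - 1) * ((u : ℝ) + 1) ^ (-degreeExponent m δ)

theorem edgeWeight_eq (v u : ℕ) : edgeWeight m δ v u =
    ((v : ℝ) + 1)⁻¹ * Real.exp (degreeExponent m δ *
      (Real.log ((v : ℝ) + 1) - Real.log ((u : ℝ) + 1))) := by
  unfold edgeWeight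
  rw [Real.rpow_def_of_pos (by positivity), Real.rpow_def_of_pos (by positivity)]
  have h : ((v : ℝ) + 1)⁻¹ = Real.exp (-Real.log ((v : ℝ) + 1)) := by
    rw [Real.exp_neg, Real.exp_log (by positivity)]
  rw [h, ← Real.exp_add, ← Real.exp_add]
  congr 1
  ring

/-- The correction for a prescribed edge is of the order of the reciprocal of the arrival time of its
source.  This includes the first `m` edges, whose attachment is certain, because their source is
vertex `1`. -/
theorem correction_bounds (hm : 1 ≤ m) (hδ : -(m : ℝ) < δ) :
    ∃ c C : ℝ, 0 < c ∧ 0 < C ∧ ∀ (g u : E → ℕ) (n : ℕ),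
      c * ((source m n : ℝ) + 1)⁻¹ ≤ (if m ≤ n then
        (denom m δ n * (1 + (numActive g u m n : ℝ) / denom m δ n))⁻¹ else 1) ∧
      (if m ≤ n then
        (denom m δ n * (1 + (numActive g u m n : ℝ) / denom m δ n))⁻¹ else 1) ≤
        C * ((source m n : ℝ) + 1)⁻¹ := by
  obtain ⟨A, hA, hA'⟩ := denom_le hm hδ
  have hm' : (1 : ℝ) ≤ m := by exact_mod_cast hm
  have hmδ : 0 < m + δ := by linarith
  set K : ℝ := Fintype.card E * (m / (m + δ)) with hK
  have hK0 : 0 ≤ K := by positivity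
  refine ⟨(A * m * (1 + K) + 1)⁻¹, 2 * (m / (m + δ)) + 2, by positivity, by positivity,
    fun g u n => ?_⟩
  have hs : (0 : ℝ) < (source m n : ℝ) + 1 := by positivity
  split_ifs with hn
  · have hD := denom_pos hm hδ hn
    have hx0 : 0 ≤ (numActive g u m n : ℝ) / denom m δ n := by positivity
    have hx1 : (numActive g u m n : ℝ) / denom m δ n ≤ K := by
      refine (numActive_div_le hm hδ g u hn).trans (mul_le_of_le_one_right hK0 ?_)
      exact inv_le_one_of_one_le₀ (by have := n.cast_nonneg (α := ℝ); linarith)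
    constructor
    · rw [← mul_inv]
      refine inv_anti₀ (by positivity) ?_
      have h1 : (n : ℝ) + 1 ≤ m * ((source m n : ℝ) + 1) := by
        have : n + 1 ≤ m * (source m n + 1) := by
          have := Nat.lt_mul_div_succ n hm
          unfold source
          nlinarith
        exact_mod_cast this
      calc denom m δ n * (1 + (numActive g u m n : ℝ) / denom m δ n)
          ≤ (A * (m * ((source m n : ℝ) + 1))) * (1 + K) := by
            have h2 := hA' n
            have h3 : A * ((n : ℝ) + 1) ≤ A * (m * ((source m n : ℝ) + 1)) := by gcongr
            have h4 := h2.trans h3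
            gcongr
        _ ≤ (A * m * (1 + K) + 1) * ((source m n : ℝ) + 1) := by nlinarith
    · have h1 : (source m n : ℝ) + 1 ≤ 2 * ((n : ℝ) + 1) := by
        have : source m n + 1 ≤ 2 * (n + 1) := by
          have := Nat.div_le_self n m
          unfold source
          omega
        exact_mod_cast this
      calc (denom m δ n * (1 + (numActive g u m n : ℝ) / denom m δ n))⁻¹
          ≤ (denom m δ n)⁻¹ := by
            refine inv_anti₀ hD ?_
            exact le_mul_of_one_le_right hD.le (by linarith)
        _ ≤ m / (m + δ) * ((n : ℝ) + 1)⁻¹ := inv_denom_le hm hδ hn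
        _ ≤ m / (m + δ) * (2 * ((source m n : ℝ) + 1)⁻¹) := by
            have : ((n : ℝ) + 1)⁻¹ ≤ 2 * ((source m n : ℝ) + 1)⁻¹ := by
              rw [inv_le_iff_one_le_mul₀ (by positivity), ← div_eq_mul_inv, div_mul_eq_mul_div,
                one_le_div hs]
              exact h1
            gcongr
        _ ≤ (2 * (m / (m + δ)) + 2) * ((source m n : ℝ) + 1)⁻¹ := by
            have : 0 < ((source m n : ℝ) + 1)⁻¹ := by positivity
            nlinarith
  · have hsrc : (source m n : ℝ) + 1 = 2 := by
      have : source m n = 1 := by simp [source, Nat.div_eq_of_lt (not_le.mp hn)]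
      rw [this]
      norm_num
    rw [hsrc]
    have : (A * m * (1 + K) + 1)⁻¹ ≤ 1 := inv_le_one_of_one_le₀ (by
      have : 0 ≤ A * m * (1 + K) := by positivity
      linarith)
    have : 0 ≤ (m : ℝ) / (m + δ) := by positivity
    constructor <;> linarith

open Classical in
/-- Uniformly in their positions, prescribed attachments have a probability of the order of the
product of their edge weights. -/
theorem expect_agrees_bounds (hm : 1 ≤ m) (hδ : -(m : ℝ) < δ) :
    ∃ c C : ℝ, 0 < c ∧ 0 < C ∧ ∀ (g u : E → ℕ) (t : ℕ), 2 ≤ t → Function.Injective g →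
      (∀ e, g e < m * (t - 1)) → (∀ e, u e < source m (g e)) →
      c * ∏ e, edgeWeight m δ (source m (g e)) (u e) ≤
        expect hm hδ (m * (t - 1)) (fun G => if Agrees g u G then 1 else 0) ∧
      expect hm hδ (m * (t - 1)) (fun G => if Agrees g u G then 1 else 0) ≤
        C * ∏ e, edgeWeight m δ (source m (g e)) (u e) := by
  obtain ⟨c₁, C₁, hc₁, hC₁, h₁⟩ := prod_rising_bounds (E := E) hδ
  obtain ⟨c₂, C₂, hc₂, hC₂, h₂⟩ := correction_bounds (E := E) hm hδ
  obtain ⟨B, hB, hB'⟩ := abs_recipSum_sub_recipSum_le hm hδ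
  obtain ⟨S, hS, hS'⟩ := sum_inv_sq_le (m := m)
  have hm' : (1 : ℝ) ≤ m := by exact_mod_cast hm
  have hmδ : 0 < m + δ := by linarith
  set n₀ := Fintype.card E with hn₀
  set K : ℝ := n₀ * (m / (m + δ)) with hK
  refine ⟨c₁ * (Real.exp (-(K ^ 2 * S)) * (c₂ * Real.exp (-B)) ^ n₀), C₁ * (C₂ * Real.exp B) ^ n₀,
    by positivity, by positivity, fun g u t ht hg hgt hu => ?_⟩
  rw [expect_agrees hm hδ ht hg hgt hu, prod_stepFactor hm hδ hg hgt]
  obtain ⟨hr1, hr2⟩ := h₁ g u m t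
  set R := ∏ w ∈ Finset.range t, rising (m + δ) (remaining g u m w)
  have hx0 : ∀ n ∈ Finset.Ico m (m * (t - 1)), 0 ≤ (numActive g u m n : ℝ) / denom m δ n := by
    intro n hn
    have := denom_pos hm hδ (Finset.mem_Ico.mp hn).1
    positivity
  obtain ⟨hq1, hq2⟩ := prod_one_add_bounds _ hx0
  rw [sum_numActive_div hm hgt hu] at hq1 hq2
  have hsq : ∑ n ∈ Finset.Ico m (m * (t - 1)), ((numActive g u m n : ℝ) / denom m δ n) ^ 2 ≤
      K ^ 2 * S := by
    calc ∑ n ∈ Finset.Ico m (m * (t - 1)), ((numActive g u m n : ℝ) / denom m δ n) ^ 2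
        ≤ ∑ n ∈ Finset.Ico m (m * (t - 1)), K ^ 2 * (((n : ℝ) + 1) ^ 2)⁻¹ := by
          refine Finset.sum_le_sum fun n hn => ?_
          rw [← inv_pow, ← mul_pow]
          exact pow_le_pow_left₀ (hx0 n hn)
            (numActive_div_le hm hδ g u (Finset.mem_Ico.mp hn).1) 2
      _ ≤ K ^ 2 * S := by
          rw [← Finset.mul_sum]
          exact mul_le_mul_of_nonneg_left (hS' _) (by positivity)
  set Q := ∏ n ∈ Finset.Ico m (m * (t - 1)), (1 + (numActive g u m n : ℝ) / denom m δ n)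
  set Z : ℝ := ∑ e, (recipSum m δ (g e) - recipSum m δ (m * u e)) with hZ
  have hq1' : Real.exp (-(K ^ 2 * S)) * Real.exp Z ≤ Q := by
    refine le_trans ?_ hq1
    rw [← Real.exp_add]
    exact Real.exp_le_exp.mpr (by linarith)
  have hw : ∀ e, 0 < edgeWeight m δ (source m (g e)) (u e) := fun e => by
    unfold edgeWeight
    positivity
  set F : E → ℝ := fun e => if m ≤ g e then
    (denom m δ (g e) * (1 + (numActive g u m (g e) : ℝ) / denom m δ (g e)))⁻¹ else 1 with hF
  have hF0 : ∀ e, 0 ≤ F e := fun e => le_trans (by positivity) (h₂ g u (g e)).1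
  have hprod : Real.exp Z * ∏ e, F e =
      ∏ e, (Real.exp (recipSum m δ (g e) - recipSum m δ (m * u e)) * F e) := by
    rw [Finset.prod_mul_distrib, hZ, Real.exp_sum]
  have hlow : (c₂ * Real.exp (-B)) ^ n₀ * ∏ e, edgeWeight m δ (source m (g e)) (u e) ≤
      Real.exp Z * ∏ e, F e := by
    rw [hprod, hn₀, ← Finset.card_univ, ← Finset.prod_const, ← Finset.prod_mul_distrib]
    refine Finset.prod_le_prod (fun e _ => by have := hw e; positivity) fun e _ => ?_
    rw [edgeWeight_eq]
    have ha := (abs_le.mp (hB' (g e) (u e))).1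
    have hb := (h₂ g u (g e)).1
    set lg := degreeExponent m δ *
      (Real.log ((source m (g e) : ℝ) + 1) - Real.log ((u e : ℝ) + 1))
    calc c₂ * Real.exp (-B) * (((source m (g e) : ℝ) + 1)⁻¹ * Real.exp lg)
        = Real.exp (-B + lg) * (c₂ * ((source m (g e) : ℝ) + 1)⁻¹) := by
          rw [Real.exp_add]
          ring
      _ ≤ _ := by
          refine mul_le_mul (Real.exp_le_exp.mpr (by linarith)) hb (by positivity)
            (Real.exp_pos _).le
  have hupp : Real.exp Z * ∏ e, F e ≤
      (C₂ * Real.exp B) ^ n₀ * ∏ e, edgeWeight m δ (source m (g e)) (u e) := by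
    rw [hprod, hn₀, ← Finset.card_univ, ← Finset.prod_const, ← Finset.prod_mul_distrib]
    refine Finset.prod_le_prod (fun e _ => mul_nonneg (Real.exp_pos _).le (hF0 e)) fun e _ => ?_
    rw [edgeWeight_eq]
    have ha := (abs_le.mp (hB' (g e) (u e))).2
    have hb := (h₂ g u (g e)).2
    set lg := degreeExponent m δ *
      (Real.log ((source m (g e) : ℝ) + 1) - Real.log ((u e : ℝ) + 1))
    calc Real.exp (recipSum m δ (g e) - recipSum m δ (m * u e)) * F e
        ≤ Real.exp (B + lg) * (C₂ * ((source m (g e) : ℝ) + 1)⁻¹) :=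
          mul_le_mul (Real.exp_le_exp.mpr (by linarith)) hb (hF0 e) (Real.exp_pos _).le
      _ = _ := by
          rw [Real.exp_add]
          ring
  have hPF : 0 ≤ ∏ e, F e := Finset.prod_nonneg fun e _ => hF0 e
  set W := ∏ e, edgeWeight m δ (source m (g e)) (u e)
  constructor
  · calc c₁ * (Real.exp (-(K ^ 2 * S)) * (c₂ * Real.exp (-B)) ^ n₀) * W
        = c₁ * (Real.exp (-(K ^ 2 * S)) * ((c₂ * Real.exp (-B)) ^ n₀ * W)) := by ring
      _ ≤ c₁ * (Real.exp (-(K ^ 2 * S)) * (Real.exp Z * ∏ e, F e)) := by gcongr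
      _ = c₁ * ((Real.exp (-(K ^ 2 * S)) * Real.exp Z) * ∏ e, F e) := by ring
      _ ≤ c₁ * (Q * ∏ e, F e) := by gcongr
      _ ≤ R * (Q * ∏ e, F e) := by
          have : 0 ≤ Q := le_trans (by positivity) hq1'
          gcongr
  · calc R * (Q * ∏ e, F e) ≤ C₁ * (Real.exp Z * ∏ e, F e) := by
          have : 0 ≤ Q := le_trans (by positivity) hq1'
          gcongr
      _ ≤ C₁ * ((C₂ * Real.exp B) ^ n₀ * W) := by gcongr
      _ = C₁ * (C₂ * Real.exp B) ^ n₀ * W := by ring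

end bounds

open DirGraph

variable {V E : Type*} [Fintype V] [Fintype E]

/-! ### Vertex weights and orderings -/

theorem degreeExponent_eq_tau {m : ℕ} {δ : ℝ} (hm : 1 ≤ m) (hδ : -(m : ℝ) < δ) :
    (tau m δ - 2) / (tau m δ - 1) = 1 - degreeExponent m δ := by
  have hm' : (1 : ℝ) ≤ m := by exact_mod_cast hm
  have h1 : 2 * (m : ℝ) + δ ≠ 0 := by linarith
  have h2 : tau m δ - 1 = (2 * m + δ) / m := by
    unfold tau
    field_simp
    ring
  have h3 : tau m δ - 2 = (m + δ) / m := by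
    unfold tau
    field_simp
    ring
  rw [h2, h3, div_div_div_cancel_right₀ (by linarith), degreeExponent, eq_sub_iff_add_eq,
    ← add_div, div_eq_one_iff_eq h1]
  ring

/-- Collecting the factors of the edge weights at each vertex gives the exponents `β`. -/
theorem prod_edgeWeight {m : ℕ} {δ : ℝ} (hm : 1 ≤ m) (hδ : -(m : ℝ) < δ) (H : DirGraph V E)
    (f : V → ℕ) : ∏ e, edgeWeight m δ (f (H.src e)) (f (H.tgt e)) =
      ∏ v, ((f v : ℝ) + 1) ^ H.beta m δ v := by
  classical
  have key : ∀ (h : E → V) (a : ℝ), ∏ e, ((f (h e) : ℝ) + 1) ^ a =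
      ∏ v, ((f v : ℝ) + 1) ^ (a * (Finset.univ.filter fun e => h e = v).card) := by
    intro h a
    rw [← Finset.prod_fiberwise' Finset.univ h (fun v => ((f v : ℝ) + 1) ^ a)]
    refine Finset.prod_congr rfl fun v _ => ?_
    rw [Finset.prod_const, Real.rpow_mul (by positivity), Real.rpow_natCast]
  unfold edgeWeight
  rw [Finset.prod_mul_distrib, key H.src, key H.tgt, ← Finset.prod_mul_distrib]
  refine Finset.prod_congr rfl fun v _ => ?_
  rw [← Real.rpow_add (by positivity)]
  congr 1
  unfold beta
  rw [degreeExponent_eq_tau hm hδ]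
  have h1 : H.inDegree v = (Finset.univ.filter fun e => H.tgt e = v).card := by
    unfold inDegree
    congr
  have h2 : H.outDegree v = (Finset.univ.filter fun e => H.src e = v).card := by
    unfold outDegree
    congr
  rw [h1, h2]
  ring

theorem objective_eq_tailWeight (H : DirGraph V E) (m : ℕ) (δ : ℝ) (π : Ordering V)
    (s : Fin (Fintype.card V + 1)) :
    H.objective m δ π s = tailWeight (fun i => H.beta m δ (π.symm i)) s - Fintype.card V := by
  unfold objective tailWeight
  rw [Finset.sum_add_distrib, Finset.sum_const]
  have hc : (Finset.univ.filter fun i : Fin (Fintype.card V) => (s : ℕ) ≤ i).card =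
      Fintype.card V - s := by
    have h1 := Finset.card_filter_add_card_filter_not (s := Finset.univ)
      (p := fun i : Fin (Fintype.card V) => (s : ℕ) ≤ i)
    simp only [not_le, Fin.card_filter_val_lt, Finset.card_univ, Fintype.card_fin] at h1
    omega
  have hs : (s : ℕ) ≤ Fintype.card V := by omega
  rw [hc, nsmul_eq_mul, Nat.cast_sub hs]
  ring

theorem orderedExponent_eq (H : DirGraph V E) (m : ℕ) (δ : ℝ) (π : Ordering V) :
    H.orderedExponent m δ π = maxTail (fun i => H.beta m δ (π.symm i)) - Fintype.card V := by
  unfold orderedExponent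
  apply le_antisymm
  · refine Finset.sup'_le _ _ fun s _ => ?_
    rw [objective_eq_tailWeight]
    linarith [tailWeight_le_maxTail (fun i => H.beta m δ (π.symm i)) s]
  · obtain ⟨s, hs⟩ := exists_tailWeight_eq fun i => H.beta m δ (π.symm i)
    rw [← hs, ← objective_eq_tailWeight]
    exact Finset.le_sup' (H.objective m δ π) (Finset.mem_univ s)

theorem numOptimizers_eq (H : DirGraph V E) (m : ℕ) (δ : ℝ) (π : Ordering V) :
    H.numOptimizers m δ π = numMaxTail (fun i => H.beta m δ (π.symm i)) := by
  unfold numOptimizers numMaxTail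
  simp only [objective_eq_tailWeight, orderedExponent_eq, sub_left_inj]

/-- The vertices of a copy, sorted by age, determine an ordering. -/
theorem exists_ordering_strictMono {f : V → ℕ} (hf : Function.Injective f) :
    ∃ π : Ordering V, StrictMono (f ∘ π.symm) := by
  let _ : LinearOrder V := LinearOrder.lift' f hf
  let o := Fintype.orderIsoFinOfCardEq V rfl
  refine ⟨o.symm.toEquiv, fun i j hij => ?_⟩
  exact o.strictMono hij

/-! ### Counting copies -/

theorem expectedCopies_eq {m : ℕ} {δ : ℝ} (hm : 1 ≤ m) (hδ : -(m : ℝ) < δ) (H : DirGraph V E)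
    (t : ℕ) : expectedCopies hm hδ H t =
      expect hm hδ (m * (t - 1)) fun G => (H.numCopies t G : ℝ) := by
  unfold expectedCopies expect PA
  rw [PMF.integral_eq_sum]
  rfl

theorem agrees_iff {ι : Type*} {m N : ℕ} {g : ι → Fin N} {u : ι → ℕ} {G : Attachments m N} :
    Agrees (fun e => (g e : ℕ)) u G ↔ ∀ e, (G (g e) : ℕ) = u e :=
  ⟨fun h e => h e (g e).isLt, fun h e _ => h e⟩

open Classical in
/-- The pairs of a vertex map and an edge map that embed `H` into a preferential attachment graph,
provided that the end points of the edges are as prescribed. -/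
noncomputable def embeddings (H : DirGraph V E) (m t : ℕ) :
    Finset ((V ↪ Fin t) × (E ↪ Fin (m * (t - 1)))) :=
  Finset.univ.filter fun p => (∀ e, source m (p.2 e) = p.1 (H.src e)) ∧
    ∀ e, p.1 (H.tgt e) < p.1 (H.src e)

open Classical in
theorem numCopies_le (H : DirGraph V E) {m t : ℕ} (G : Attachments m (m * (t - 1))) :
    (H.numCopies t G : ℝ) ≤ ∑ p ∈ embeddings H m t,
      if Agrees (fun e => (p.2 e : ℕ)) (fun e => (p.1 (H.tgt e) : ℕ)) G then (1 : ℝ) else 0 := by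
  rw [Finset.sum_boole]
  norm_cast
  set F := (embeddings H m t).filter fun p =>
    Agrees (fun e => (p.2 e : ℕ)) (fun e => (p.1 (H.tgt e) : ℕ)) G with hF
  have hsub : {c : Finset (Fin t) × Finset (Fin (m * (t - 1))) | H.IsCopy t G c.1 c.2} ⊆
      (F.image fun p => (Finset.univ.map p.1, Finset.univ.map p.2) :
        Finset (Finset (Fin t) × Finset (Fin (m * (t - 1))))) := by
    rintro ⟨S, M⟩ ⟨f, g, h1, h2, h3, h4⟩
    simp only [Finset.coe_image, Set.mem_image, Finset.mem_coe]
    refine ⟨(f, g), ?_, by simp [h3, h4]⟩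
    simp only [hF, embeddings, Finset.mem_filter, Finset.mem_univ, true_and, agrees_iff]
    refine ⟨⟨h1, fun e => ?_⟩, h2⟩
    have := (G (g e)).isLt
    rw [h2, h1] at this
    exact this
  calc H.numCopies t G ≤ (F.image fun p => (Finset.univ.map p.1, Finset.univ.map p.2)).card := by
        unfold numCopies
        rw [← Set.ncard_coe_finset]
        exact Set.ncard_le_ncard hsub (Finset.finite_toSet _)
    _ ≤ F.card := Finset.card_image_le

open Classical in
theorem card_edgeMaps_le {m t : ℕ} (hm : 1 ≤ m) (v : E → ℕ) :
    (Finset.univ.filter fun g : E ↪ Fin (m * (t - 1)) => ∀ e, source m (g e) = v e).card ≤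
      m ^ Fintype.card E := by
  calc _ ≤ (Finset.univ : Finset (E → Fin m)).card := by
        refine Finset.card_le_card_of_injOn
          (fun g e => ⟨(g e : ℕ) % m, Nat.mod_lt _ (by omega)⟩) (fun _ _ => Finset.mem_univ _) ?_
        intro g hg g' hg' h
        simp only [Finset.coe_filter, Finset.mem_univ, true_and, Set.mem_ofPred_eq] at hg hg'
        ext e
        have h1 := congrArg Fin.val (congrFun h e)
        have h2 := (hg e).trans (hg' e).symm
        simp only [source, Nat.succ_inj] at h1 h2
        rw [← Nat.div_add_mod (g e : ℕ) m, ← Nat.div_add_mod (g' e : ℕ) m, h1, h2]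
    _ = m ^ Fintype.card E := by simp

open Classical in
theorem sum_vertexMaps_le (H : DirGraph V E) {m : ℕ} (δ : ℝ)
    (hA : (H.attainableOrderings m).Nonempty) (t : ℕ) :
    ∑ f ∈ Finset.univ.filter (fun f : V ↪ Fin t => ∀ e, f (H.tgt e) < f (H.src e)),
        ∏ v, (((f v : ℕ) : ℝ) + 1) ^ H.beta m δ v ≤
      ∑ π ∈ H.attainableOrderings m, orderedSum (fun i => H.beta m δ (π.symm i)) t := by
  set w : (V ↪ Fin t) → ℝ := fun f => ∏ v, (((f v : ℕ) : ℝ) + 1) ^ H.beta m δ v with hw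
  have hw0 : ∀ f, 0 ≤ w f := fun f => Finset.prod_nonneg fun v _ => by positivity
  obtain ⟨π₀, hπ₀⟩ := hA
  have hdeg : ∀ v, H.outDegree v ≤ m := (Finset.mem_filter.mp hπ₀).2.2
  calc _ ≤ ∑ f : V ↪ Fin t, ∑ π ∈ H.attainableOrderings m,
          if StrictMono (fun i => (f (π.symm i) : ℕ)) then w f else 0 := by
        rw [Finset.sum_filter]
        refine Finset.sum_le_sum fun f _ => ?_
        split_ifs with hf
        · obtain ⟨π, hπ⟩ := exists_ordering_strictMono (f := fun v => (f v : ℕ))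
            fun a b h => f.injective (Fin.ext h)
          have hmem : π ∈ H.attainableOrderings m := by
            refine Finset.mem_filter.mpr ⟨Finset.mem_univ _, fun e => ?_, hdeg⟩
            rw [← hπ.lt_iff_lt]
            simpa using hf e
          refine le_trans ?_ (Finset.single_le_sum (f := fun π : Ordering V =>
            if StrictMono (fun i => (f (π.symm i) : ℕ)) then w f else 0) (fun π _ => ?_) hmem)
          · exact (if_pos hπ).ge
          · split_ifs
            exacts [hw0 f, le_rfl]
        · refine Finset.sum_nonneg fun π _ => ?_
          split_ifs
          exacts [hw0 f, le_rfl]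
    _ = ∑ π ∈ H.attainableOrderings m, ∑ f : V ↪ Fin t,
          if StrictMono (fun i => (f (π.symm i) : ℕ)) then w f else 0 := Finset.sum_comm
    _ ≤ _ := by
        refine Finset.sum_le_sum fun π _ => ?_
        rw [← Finset.sum_filter]
        unfold orderedSum
        have hinj : Set.InjOn (fun (f : V ↪ Fin t) i => (f (π.symm i) : ℕ))
            (Finset.univ.filter fun f : V ↪ Fin t =>
              StrictMono (fun i => (f (π.symm i) : ℕ)) : Finset _) := by
          intro f _ f' _ h
          ext v
          simpa using congrFun h (π v)
        have himage := Finset.sum_image (f := fun q : Fin (Fintype.card V) → ℕ =>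
          ∏ i, ((q i : ℝ) + 1) ^ H.beta m δ (π.symm i)) hinj
        have hprod : ∀ f : V ↪ Fin t, w f =
            ∏ i, (((f (π.symm i) : ℕ) : ℝ) + 1) ^ H.beta m δ (π.symm i) := fun f =>
          (Equiv.prod_comp π.symm fun v => (((f v : ℕ) : ℝ) + 1) ^ H.beta m δ v).symm
        simp only [hprod]
        rw [← himage]
        refine Finset.sum_le_sum_of_subset_of_nonneg ?_ fun q _ _ => by positivity
        intro q hq
        obtain ⟨f, hf, rfl⟩ := Finset.mem_image.mp hq
        exact mem_increasingTuples.mpr ⟨fun i => (f _).isLt, (Finset.mem_filter.mp hf).2⟩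

theorem expectedCopies_le {m : ℕ} {δ : ℝ} (hm : 1 ≤ m) (hδ : -(m : ℝ) < δ) (H : DirGraph V E)
    (hA : (H.attainableOrderings m).Nonempty) :
    ∃ C : ℝ, 0 < C ∧ ∀ t, 2 ≤ t → expectedCopies hm hδ H t ≤
      C * ∑ π ∈ H.attainableOrderings m, orderedSum (fun i => H.beta m δ (π.symm i)) t := by
  classical
  obtain ⟨c, C, -, hC, hb⟩ := expect_agrees_bounds (E := E) hm hδ
  refine ⟨C * m ^ Fintype.card E, by positivity, fun t ht => ?_⟩
  set w : (V ↪ Fin t) → ℝ := fun f => ∏ v, (((f v : ℕ) : ℝ) + 1) ^ H.beta m δ v with hw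
  have hw0 : ∀ f, 0 ≤ w f := fun f => Finset.prod_nonneg fun v _ => by positivity
  have hterm : ∀ p ∈ embeddings H m t, expect hm hδ (m * (t - 1)) (fun G =>
      if Agrees (fun e => (p.2 e : ℕ)) (fun e => (p.1 (H.tgt e) : ℕ)) G then (1 : ℝ) else 0) ≤
      C * w p.1 := by
    rintro ⟨f, g⟩ hp
    obtain ⟨h1, h2⟩ := (Finset.mem_filter.mp hp).2
    have := (hb (fun e => (g e : ℕ)) (fun e => (f (H.tgt e) : ℕ)) t ht
      (fun a b h => g.injective (Fin.ext h)) (fun e => (g e).isLt)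
      (fun e => lt_of_lt_of_eq (Fin.lt_def.mp (h2 e)) (h1 e).symm)).2
    simp only at h1
    simp only [h1] at this
    rw [prod_edgeWeight hm hδ H fun v => (f v : ℕ)] at this
    convert this
  rw [expectedCopies_eq]
  calc _ ≤ _ := expect_mono hm hδ fun G => numCopies_le H G
    _ = _ := expect_sum hm hδ _ _
    _ ≤ ∑ p ∈ embeddings H m t, C * w p.1 := Finset.sum_le_sum hterm
    _ = ∑ f : V ↪ Fin t, ∑ g : E ↪ Fin (m * (t - 1)),
          if (∀ e, source m (g e) = f (H.src e)) ∧ ∀ e, f (H.tgt e) < f (H.src e)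
            then C * w f else 0 := by
        unfold embeddings
        rw [Finset.sum_filter, Fintype.sum_prod_type]
    _ ≤ ∑ f ∈ Finset.univ.filter (fun f : V ↪ Fin t => ∀ e, f (H.tgt e) < f (H.src e)),
          C * m ^ Fintype.card E * w f := by
        rw [Finset.sum_filter]
        refine Finset.sum_le_sum fun f _ => ?_
        split_ifs with hf
        · have hiff : ∀ g : E ↪ Fin (m * (t - 1)), ((∀ e, source m (g e) = f (H.src e)) ∧
              ∀ e, f (H.tgt e) < f (H.src e)) ↔ ∀ e, source m (g e) = f (H.src e) :=
            fun g => and_iff_left hf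
          simp only [hiff]
          rw [← Finset.sum_filter, Finset.sum_const, nsmul_eq_mul]
          have hcard : ((Finset.univ.filter fun g : E ↪ Fin (m * (t - 1)) =>
              ∀ e, source m (g e) = f (H.src e)).card : ℝ) ≤ (m : ℝ) ^ Fintype.card E := by
            exact_mod_cast card_edgeMaps_le hm fun e => (f (H.src e) : ℕ)
          have h0 : 0 ≤ C * w f := mul_nonneg hC.le (hw0 f)
          calc _ ≤ (m : ℝ) ^ Fintype.card E * (C * w f) := mul_le_mul_of_nonneg_right hcard h0
            _ = _ := by ring
        · exact (Finset.sum_eq_zero fun g _ => if_neg fun h => hf h.2).le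
    _ ≤ _ := by
        rw [← Finset.mul_sum]
        exact mul_le_mul_of_nonneg_left (sum_vertexMaps_le H δ hA t) (by positivity)

/-- The edges leaving each vertex can be given different labels. -/
theorem exists_labels {V E : Type*} [Fintype E] (H : DirGraph V E)
    {m : ℕ} (h : ∀ v, H.outDegree v ≤ m) :
    ∃ l : E → Fin m, ∀ a b, H.src a = H.src b → l a = l b → a = b := by
  classical
  have hex : ∀ v, Nonempty ({e // H.src e = v} ↪ Fin m) := by
    intro v
    refine Function.Embedding.nonempty_of_card_le ?_
    rw [Fintype.card_fin, Fintype.card_subtype]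
    refine le_trans (le_of_eq ?_) (h v)
    unfold outDegree
    congr
  let φ := fun v => (hex v).some
  refine ⟨fun e => φ (H.src e) ⟨e, rfl⟩, fun a b hab hl => ?_⟩
  have hcast : ∀ v, ∀ h : H.src b = v, φ v ⟨b, h⟩ = φ (H.src b) ⟨b, rfl⟩ := by
    rintro v rfl
    rfl
  dsimp only at hl
  rw [← hcast _ hab.symm] at hl
  exact congrArg Subtype.val ((φ (H.src a)).injective hl)

/-- The number of the edge with label `l` of the vertex `v ≥ 1`. -/
def edgeNumber (m v l : ℕ) : ℕ := m * (v - 1) + l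

theorem source_edgeNumber {m v l : ℕ} (hv : 1 ≤ v) (hl : l < m) :
    source m (edgeNumber m v l) = v := by
  unfold source edgeNumber
  rw [Nat.mul_add_div (by omega), Nat.div_eq_of_lt hl]
  omega

theorem edgeNumber_mod {m v l : ℕ} (hl : l < m) : edgeNumber m v l % m = l := by
  unfold edgeNumber
  rw [Nat.mul_add_mod, Nat.mod_eq_of_lt hl]

theorem edgeNumber_lt {m v l t : ℕ} (hv : 1 ≤ v) (hl : l < m) (ht : v < t) :
    edgeNumber m v l < m * (t - 1) := by
  unfold edgeNumber
  calc m * (v - 1) + l < m * (v - 1) + m := by omega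
    _ = m * v := by
        obtain ⟨k, rfl⟩ : ∃ k, v = k + 1 := ⟨v - 1, by omega⟩
        rw [Nat.add_sub_cancel]
        ring
    _ ≤ m * (t - 1) := Nat.mul_le_mul_left m (by omega)

section lower

variable {m : ℕ} (H : DirGraph V E) {π : Ordering V} {l : E → Fin m} {t : ℕ}
  {q : Fin (Fintype.card V) → ℕ}

theorem source_edgeNumber_tuple (hπ : H.Attainable m π) (hq : StrictMono q) (e : E) :
    1 ≤ q (π (H.src e)) ∧
      source m (edgeNumber m (q (π (H.src e))) (l e)) = q (π (H.src e)) := by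
  have h : q (π (H.tgt e)) < q (π (H.src e)) := hq (hπ.1 e)
  exact ⟨by omega, source_edgeNumber (by omega) (l e).isLt⟩

theorem edgeNumber_tuple_injective (hπ : H.Attainable m π)
    (hl : ∀ a b, H.src a = H.src b → l a = l b → a = b) (hq : StrictMono q) :
    Function.Injective fun e => edgeNumber m (q (π (H.src e))) (l e) := by
  intro a b h
  dsimp only at h
  apply hl
  · have h1 := (source_edgeNumber_tuple H (l := l) hπ hq a).2
    rw [h, (source_edgeNumber_tuple H hπ hq b).2] at h1
    exact π.injective (hq.injective h1.symm)
  · have h1 := edgeNumber_mod (v := q (π (H.src a))) (l a).isLt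
    rw [h, edgeNumber_mod (l b).isLt] at h1
    exact Fin.ext h1.symm

open Classical in
/-- Different increasing tuples have different vertex sets, so each one whose edges are attached as
prescribed contributes a copy of its own. -/
theorem le_numCopies (hπ : H.Attainable m π)
    (hl : ∀ a b, H.src a = H.src b → l a = l b → a = b) (G : Attachments m (m * (t - 1))) :
    ∑ q ∈ increasingTuples (Fintype.card V) t,
      (if Agrees (fun e => edgeNumber m (q (π (H.src e))) (l e)) (fun e => q (π (H.tgt e))) G
        then (1 : ℝ) else 0) ≤ H.numCopies t G := by
  rw [Finset.sum_boole]
  norm_cast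
  set F := (increasingTuples (Fintype.card V) t).filter fun q =>
    Agrees (fun e => edgeNumber m (q (π (H.src e))) (l e)) (fun e => q (π (H.tgt e))) G with hF
  let φ : (Fin (Fintype.card V) → ℕ) → Finset (Fin t) × Finset (Fin (m * (t - 1))) := fun q =>
    (Finset.univ.filter fun x => ∃ v, q (π v) = x,
      Finset.univ.filter fun n => ∃ e, edgeNumber m (q (π (H.src e))) (l e) = n)
  have hφ : Set.InjOn φ F := by
    intro q hq q' hq' h
    obtain ⟨hlt, hmono⟩ := mem_increasingTuples.mp (Finset.mem_filter.mp hq).1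
    obtain ⟨hlt', hmono'⟩ := mem_increasingTuples.mp (Finset.mem_filter.mp hq').1
    have hS := congrArg Prod.fst h
    simp only [φ] at hS
    rw [← hmono.range_inj hmono']
    have hmem : ∀ n (hn : n < t), (∃ v, q (π v) = n) ↔ ∃ v, q' (π v) = n := by
      intro n hn
      have := Finset.ext_iff.mp hS ⟨n, hn⟩
      simpa using this
    ext n
    constructor
    · rintro ⟨i, rfl⟩
      obtain ⟨v, hv⟩ := (hmem _ (hlt i)).mp ⟨π.symm i, by simp⟩
      exact ⟨_, hv⟩
    · rintro ⟨i, rfl⟩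
      obtain ⟨v, hv⟩ := (hmem _ (hlt' i)).mpr ⟨π.symm i, by simp⟩
      exact ⟨_, hv⟩
  rw [← Finset.card_image_of_injOn hφ, ← Set.ncard_coe_finset]
  refine Set.ncard_le_ncard ?_ (Set.toFinite _)
  intro c hc
  obtain ⟨q, hq, rfl⟩ := Finset.mem_image.mp (Finset.mem_coe.mp hc)
  obtain ⟨hq1, hag⟩ := Finset.mem_filter.mp hq
  obtain ⟨hlt, hmono⟩ := mem_increasingTuples.mp hq1
  have hNlt : ∀ e, edgeNumber m (q (π (H.src e))) (l e) < m * (t - 1) := fun e =>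
    edgeNumber_lt (source_edgeNumber_tuple H (l := l) hπ hmono e).1 (l e).isLt (hlt _)
  refine ⟨⟨fun v => ⟨q (π v), hlt _⟩, fun a b h => ?_⟩,
    ⟨fun e => ⟨edgeNumber m (q (π (H.src e))) (l e), hNlt e⟩, fun a b h => ?_⟩, ?_, ?_, ?_, ?_⟩
  · exact π.injective (hmono.injective (congrArg Fin.val h))
  · exact edgeNumber_tuple_injective H hπ hl hmono (congrArg Fin.val h)
  · exact fun e => (source_edgeNumber_tuple H hπ hmono e).2
  · exact fun e => hag e (hNlt e)
  · ext x
    simp only [φ, Fin.ext_iff, Finset.mem_map, Finset.mem_univ, true_and, Finset.mem_filter]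
    rfl
  · ext x
    simp only [φ, Fin.ext_iff, Finset.mem_map, Finset.mem_univ, true_and, Finset.mem_filter]
    rfl

end lower

theorem le_expectedCopies {m : ℕ} {δ : ℝ} (hm : 1 ≤ m) (hδ : -(m : ℝ) < δ) (H : DirGraph V E)
    {π : Ordering V} (hπ : H.Attainable m π) :
    ∃ c : ℝ, 0 < c ∧ ∀ t, 2 ≤ t →
      c * orderedSum (fun i => H.beta m δ (π.symm i)) t ≤ expectedCopies hm hδ H t := by
  classical
  obtain ⟨c, C, hc, -, hb⟩ := expect_agrees_bounds (E := E) hm hδ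
  obtain ⟨l, hl⟩ := exists_labels H hπ.2
  refine ⟨c, hc, fun t ht => ?_⟩
  rw [expectedCopies_eq]
  calc c * orderedSum (fun i => H.beta m δ (π.symm i)) t
      = ∑ q ∈ increasingTuples (Fintype.card V) t,
          c * ∏ i, ((q i : ℝ) + 1) ^ H.beta m δ (π.symm i) := Finset.mul_sum _ _ _
    _ ≤ ∑ q ∈ increasingTuples (Fintype.card V) t, expect hm hδ (m * (t - 1)) (fun G =>
          if Agrees (fun e => edgeNumber m (q (π (H.src e))) (l e)) (fun e => q (π (H.tgt e))) G
            then (1 : ℝ) else 0) := by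
        refine Finset.sum_le_sum fun q hq => ?_
        obtain ⟨hlt, hmono⟩ := mem_increasingTuples.mp hq
        have hsrc := fun e => source_edgeNumber_tuple H (l := l) hπ hmono e
        have := (hb (fun e => edgeNumber m (q (π (H.src e))) (l e)) (fun e => q (π (H.tgt e))) t ht
          (edgeNumber_tuple_injective H hπ hl hmono)
          (fun e => edgeNumber_lt (hsrc e).1 (l e).isLt (hlt _))
          (fun e => (hmono (hπ.1 e)).trans_eq (hsrc e).2.symm)).1
        simp only [fun e => (hsrc e).2] at this
        rw [prod_edgeWeight hm hδ H fun v => q (π v),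
          ← Equiv.prod_comp π.symm] at this
        simp only [Equiv.apply_symm_apply] at this
        convert this
    _ = _ := (expect_sum hm hδ _ _).symm
    _ ≤ _ := expect_mono hm hδ fun G => le_numCopies H hπ hl G

/-! ### The order of the expected number of copies -/

theorem scale_bounds (a : ℝ) (p : ℕ) : ∃ c C : ℝ, 0 < c ∧ 0 < C ∧ ∀ t : ℕ, 3 ≤ t →
    c * ((t : ℝ) ^ a * Real.log t ^ p) ≤ scale a p t ∧
      scale a p t ≤ C * ((t : ℝ) ^ a * Real.log t ^ p) := by
  refine ⟨min 1 (2 ^ a), max 1 (2 ^ a) * 3 ^ p, by positivity, by positivity, fun t ht => ?_⟩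
  have ht3 : (3 : ℝ) ≤ t := by exact_mod_cast ht
  have ht0 : (0 : ℝ) < t := by linarith
  have hlog1 : 1 ≤ Real.log t := by
    rw [Real.le_log_iff_exp_le ht0]
    linarith [Real.exp_one_lt_d9]
  have hlog2 : Real.log t ≤ 1 + Real.log ((t : ℝ) + 1) := by
    linarith [Real.log_le_log ht0 (by linarith : (t : ℝ) ≤ t + 1)]
  have hlog3 : 1 + Real.log ((t : ℝ) + 1) ≤ 3 * Real.log t := by
    have h := Real.log_le_log (by linarith) (by linarith : (t : ℝ) + 1 ≤ 2 * t)
    rw [Real.log_mul two_ne_zero ht0.ne'] at h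
    linarith [Real.log_two_lt_d9]
  -- `x ^ a` is monotone or antitone in `x` according to the sign of `a`
  have hpow : min 1 (2 ^ a) * (t : ℝ) ^ a ≤ ((t : ℝ) + 1) ^ a ∧
      ((t : ℝ) + 1) ^ a ≤ max 1 (2 ^ a) * (t : ℝ) ^ a := by
    have hta : 0 < (t : ℝ) ^ a := by positivity
    have h2 : (2 : ℝ) ^ a * (t : ℝ) ^ a = (2 * (t : ℝ)) ^ a :=
      (Real.mul_rpow (by norm_num) ht0.le).symm
    rcases le_total 0 a with ha | ha
    · constructor
      · calc min 1 (2 ^ a) * (t : ℝ) ^ a ≤ 1 * (t : ℝ) ^ a := by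
              gcongr
              exact min_le_left _ _
          _ ≤ ((t : ℝ) + 1) ^ a := by
              rw [one_mul]
              exact Real.rpow_le_rpow ht0.le (by linarith) ha
      · calc ((t : ℝ) + 1) ^ a ≤ (2 * (t : ℝ)) ^ a :=
              Real.rpow_le_rpow (by positivity) (by linarith) ha
          _ = 2 ^ a * (t : ℝ) ^ a := h2.symm
          _ ≤ max 1 (2 ^ a) * (t : ℝ) ^ a := by
              gcongr
              exact le_max_right _ _
    · constructor
      · calc min 1 (2 ^ a) * (t : ℝ) ^ a ≤ 2 ^ a * (t : ℝ) ^ a := by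
              gcongr
              exact min_le_right _ _
          _ = (2 * (t : ℝ)) ^ a := h2
          _ ≤ ((t : ℝ) + 1) ^ a :=
              Real.rpow_le_rpow_of_nonpos (by positivity) (by linarith) ha
      · calc ((t : ℝ) + 1) ^ a ≤ 1 * (t : ℝ) ^ a := by
              rw [one_mul]
              exact Real.rpow_le_rpow_of_nonpos ht0 (by linarith) ha
          _ ≤ max 1 (2 ^ a) * (t : ℝ) ^ a := by
              gcongr
              exact le_max_left _ _
  have hl0 : 0 ≤ Real.log t := by linarith
  unfold scale
  constructor
  · rw [← mul_assoc]
    exact mul_le_mul hpow.1 (pow_le_pow_left₀ hl0 hlog2 p) (by positivity) (by positivity)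
  · calc ((t : ℝ) + 1) ^ a * (1 + Real.log ((t : ℝ) + 1)) ^ p
        ≤ (max 1 (2 ^ a) * (t : ℝ) ^ a) * (3 * Real.log t) ^ p :=
          mul_le_mul hpow.2 (pow_le_pow_left₀ (by linarith) hlog3 p)
            (pow_nonneg (by linarith) p) (by positivity)
      _ = _ := by
          rw [mul_pow]
          ring

theorem orderedSum_le_scale (H : DirGraph V E) {m : ℕ} {δ : ℝ}
    (hA : (H.attainableOrderings m).Nonempty) {π : Ordering V}
    (hπ : π ∈ H.attainableOrderings m) :
    ∃ C : ℝ, 0 < C ∧ ∀ t, orderedSum (fun i => H.beta m δ (π.symm i)) t ≤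
      C * scale (Fintype.card V + H.exponent m δ hA) (H.maxNumOptimizers m δ hA - 1) t := by
  obtain ⟨⟨A, hA0, hA'⟩, -⟩ := orderedSum_bounds fun i => H.beta m δ (π.symm i)
  have hB : maxTail (fun i => H.beta m δ (π.symm i)) =
      Fintype.card V + H.orderedExponent m δ π := by
    rw [orderedExponent_eq]
    ring
  rw [hB, ← numOptimizers_eq] at hA'
  have hle : H.orderedExponent m δ π ≤ H.exponent m δ hA :=
    Finset.le_sup' (H.orderedExponent m δ) hπ
  have hcase : Fintype.card V + H.orderedExponent m δ π < Fintype.card V + H.exponent m δ hA ∨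
      Fintype.card V + H.orderedExponent m δ π = Fintype.card V + H.exponent m δ hA ∧
        H.numOptimizers m δ π - 1 ≤ H.maxNumOptimizers m δ hA - 1 := by
    rcases hle.lt_or_eq with h | h
    · exact Or.inl (by linarith)
    · refine Or.inr ⟨by rw [h], Nat.sub_le_sub_right ?_ 1⟩
      unfold maxNumOptimizers
      exact Finset.le_sup (f := H.numOptimizers m δ) (Finset.mem_filter.mpr ⟨hπ, h⟩)
  obtain ⟨D, hD, hD'⟩ := scale_le_scale hcase
  refine ⟨A * D, mul_pos hA0 hD, fun t => (hA' t).trans ?_⟩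
  rw [mul_assoc]
  exact mul_le_mul_of_nonneg_left (hD' t) hA0.le

theorem exists_dominant_ordering (H : DirGraph V E) (m : ℕ) (δ : ℝ)
    (hA : (H.attainableOrderings m).Nonempty) :
    ∃ π, H.Attainable m π ∧ H.orderedExponent m δ π = H.exponent m δ hA ∧
      H.numOptimizers m δ π = H.maxNumOptimizers m δ hA := by
  classical
  obtain ⟨π₀, h₀, h₀'⟩ := Finset.exists_mem_eq_sup' hA (H.orderedExponent m δ)
  have hne : ((H.attainableOrderings m).filter fun π =>
      H.orderedExponent m δ π = H.exponent m δ hA).Nonempty :=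
    ⟨π₀, Finset.mem_filter.mpr ⟨h₀, h₀'.symm⟩⟩
  obtain ⟨π, h, h'⟩ := Finset.exists_mem_eq_sup _ hne (H.numOptimizers m δ)
  obtain ⟨h1, h2⟩ := Finset.mem_filter.mp h
  refine ⟨π, (Finset.mem_filter.mp h1).2, h2, ?_⟩
  rw [← h']
  unfold maxNumOptimizers
  congr

end PrefAttach

theorem corollary2 {V E : Type*} [Fintype V] [Fintype E] (m : ℕ) (δ : ℝ) (hm : 1 ≤ m)
    (hδ : -(m : ℝ) < δ) (H : PrefAttach.DirGraph V E) (hH : H.Connected)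
    (hA : (H.attainableOrderings m).Nonempty) :
    ∃ C₁ C₂ : ℝ, 0 < C₁ ∧ C₁ ≤ C₂ ∧ ∀ᶠ t : ℕ in Filter.atTop,
      C₁ ≤ PrefAttach.expectedCopies hm hδ H t /
          ((t : ℝ) ^ ((Fintype.card V : ℝ) + H.exponent m δ hA) *
            Real.log t ^ (H.maxNumOptimizers m δ hA - 1)) ∧
      PrefAttach.expectedCopies hm hδ H t /
          ((t : ℝ) ^ ((Fintype.card V : ℝ) + H.exponent m δ hA) *
            Real.log t ^ (H.maxNumOptimizers m δ hA - 1)) ≤ C₂ := by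
  obtain ⟨c₁, C₁, hc₁, hC₁, hscale⟩ := PrefAttach.scale_bounds
    ((Fintype.card V : ℝ) + H.exponent m δ hA) (H.maxNumOptimizers m δ hA - 1)
  obtain ⟨C₂, hC₂, hup⟩ := PrefAttach.expectedCopies_le hm hδ H hA
  have hsum : ∃ C : ℝ, 0 < C ∧ ∀ t, ∑ π ∈ H.attainableOrderings m,
      PrefAttach.orderedSum (fun i => H.beta m δ (π.symm i)) t ≤
      C * PrefAttach.scale (Fintype.card V + H.exponent m δ hA)
        (H.maxNumOptimizers m δ hA - 1) t := by
    choose! C hC hC' using fun π (hπ : π ∈ H.attainableOrderings m) =>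
      PrefAttach.orderedSum_le_scale (δ := δ) H hA hπ
    refine ⟨∑ π ∈ H.attainableOrderings m, C π, Finset.sum_pos hC hA, fun t => ?_⟩
    rw [Finset.sum_mul]
    exact Finset.sum_le_sum fun π hπ => hC' π hπ t
  obtain ⟨C₃, hC₃, hsum⟩ := hsum
  obtain ⟨π, hπ, hπB, hπr⟩ := PrefAttach.exists_dominant_ordering H m δ hA
  obtain ⟨c₂, hc₂, hlow⟩ := PrefAttach.le_expectedCopies hm hδ H hπ
  obtain ⟨-, c₃, hc₃, hos⟩ := PrefAttach.orderedSum_bounds fun i => H.beta m δ (π.symm i)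
  have hB : PrefAttach.maxTail (fun i => H.beta m δ (π.symm i)) =
      Fintype.card V + H.exponent m δ hA := by
    rw [← hπB, PrefAttach.orderedExponent_eq]
    ring
  rw [hB, ← PrefAttach.numOptimizers_eq, hπr] at hos
  have hev : ∀ᶠ t : ℕ in Filter.atTop,
      c₂ * (c₃ * c₁) ≤ PrefAttach.expectedCopies hm hδ H t /
          ((t : ℝ) ^ ((Fintype.card V : ℝ) + H.exponent m δ hA) *
            Real.log t ^ (H.maxNumOptimizers m δ hA - 1)) ∧
      PrefAttach.expectedCopies hm hδ H t /
          ((t : ℝ) ^ ((Fintype.card V : ℝ) + H.exponent m δ hA) *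
            Real.log t ^ (H.maxNumOptimizers m δ hA - 1)) ≤ C₂ * (C₃ * C₁) := by
    filter_upwards [hos, Filter.eventually_ge_atTop 3] with t hos ht
    obtain ⟨hs1, hs2⟩ := hscale t ht
    have ht3 : (3 : ℝ) ≤ t := by exact_mod_cast ht
    have hlog : 0 < Real.log t := Real.log_pos (by linarith)
    have hD : 0 < (t : ℝ) ^ ((Fintype.card V : ℝ) + H.exponent m δ hA) *
        Real.log t ^ (H.maxNumOptimizers m δ hA - 1) :=
      mul_pos (Real.rpow_pos_of_pos (by linarith) _) (pow_pos hlog _)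
    rw [le_div_iff₀ hD, div_le_iff₀ hD, mul_assoc, mul_assoc, mul_assoc, mul_assoc]
    exact ⟨(mul_le_mul_of_nonneg_left ((mul_le_mul_of_nonneg_left hs1 hc₃.le).trans hos)
        hc₂.le).trans (hlow t (by omega)),
      (hup t (by omega)).trans (mul_le_mul_of_nonneg_left
        ((hsum t).trans (mul_le_mul_of_nonneg_left hs2 hC₃.le)) hC₂.le)⟩
  refine ⟨c₂ * (c₃ * c₁), C₂ * (C₃ * C₁), by positivity, ?_, hev⟩
  obtain ⟨t, h1, h2⟩ := hev.exists
  exact h1.trans h2
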